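/- For every $n\ge 1$ let $m=m(n)\ge n$ and $b_n$ be integers such that $b_n\ge n^{\alpha}$ for some fixed $\alpha\in(0,1]$, and $\ln m=o(n^{\delta})$ as $n\to\infty$ for every $\delta>0$. Let $Q=(q_{jk})$ be a non-random $m\times n$ matrix with entries in $\{0,1\}$ such that for each $j=1,\dots,m$ exactly $b_n$ of the numbers $q_{j1},\dots,q_{jn}$ are nonzero. Let $a_{jk}$ ($1\le j\le m$, $1\le k\le n$) be i.i.d. Cauchy random variables with density $\frac{1}{\pi(1+x^2)}$, put $\Gamma_{jk}=q_{jk}a_{jk}$, let $\lambda_1\ge\dots\ge\lambda_n$ be the eigenvalues of $\Gamma^t\Gamma$, and put $\tilde\lambda_i=\lambda_i/(m^2b_n^2)$. Let $D=\{z\in\mathbb C:\operatorname{Re} z>0\}$, with the branch of $\sqrt z$ on $D$ for which $\sqrt 1=1$; the power $-1/2$ of the determinant below is the branch holomorphic in $z\in D$ that is positive for $z>0$. Then: (1) For every $z\in D$, $$E\Bigl(\det\bigl(1+\tfrac{z}{m^2b_n^2}\Gamma^t\Gamma\bigr)\Bigr)^{-1/2}=E\prod_{i=1}^n(1+z\tilde\lambda_i)^{-1/2}\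 \longrightarrow\ \exp\Bigl(-\frac{2}{\pi}\sqrt z\Bigr)\qquad(n\to\infty),$$ uniformly on compact subsets of $D$. (2) For every $z\in D$, $$\exp\Bigl(-\frac{2}{\pi}\sqrt z\Bigr)=\mathbf E\prod_{i=1}^{\infty}(1+zx_i)^{-1/2},$$ where $\mathbf E$ is the expectation over the points $x_1,x_2,\dots$ of the Poisson point process on $(0,\infty)$ with intensity $\frac{1}{\pi x^{3/2}}$. (3) For real $t\ge 0$ and every $\epsilon>0$, $$E\Bigl(\det\bigl(1+\tfrac{t^2}{m^2b_n^2}\Gamma^t\Gamma\bigr)\Bigr)^{-1/2}=E\prod_{i=1}^n(1+t^2\tilde\lambda_i)^{-1/2}=\exp\Bigl(-\frac{2}{\pi}\,t\,\bigl(1+o(b_n^{-1/2+\epsilon})\bigr)\Bigr),$$ where the $o(\cdot)$ is uniform for $t$ in compact subsets of $[0,\infty)$. -/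

import Mathlib

open MeasureTheory ProbabilityTheory Filter Topology Asymptotics
open scoped Matrix

namespace CauchyMatrix

/-- The open right half-plane `D = {z : Re z > 0}`. -/
def halfPlane : Set ℂ := {z | 0 < z.re}

/-- The sparse random matrix `Γ` with entries `Γ_jk = q_jk * a_jk`, at the sample point `ω`. -/
def sparse {Ω : Type*} {m n : ℕ} (Q : Matrix (Fin m) (Fin n) ℝ)
    (a : Fin m → Fin n → Ω → ℝ) (ω : Ω) : Matrix (Fin m) (Fin n) ℝ :=
  Matrix.of fun j k => Q j k * a j k ω

theorem isHermitian_gram {m n : ℕ} (G : Matrix (Fin m) (Fin n) ℝ) : (Gᵀ * G).IsHermitian := by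
  simpa using Matrix.isHermitian_conjTranspose_mul_self G

theorem posSemidef_gram {m n : ℕ} (G : Matrix (Fin m) (Fin n) ℝ) : (Gᵀ * G).PosSemidef := by
  simpa using Matrix.posSemidef_conjTranspose_mul_self G

/-- The eigenvalues of `Gᵀ G`, with multiplicity (the numbering plays no role below). -/
noncomputable def gramEigenvalues {m n : ℕ} (G : Matrix (Fin m) (Fin n) ℝ) : Fin n → ℝ :=
  (isHermitian_gram G).eigenvalues

/-- `g` is the branch of `z ↦ det (1 + z M) ^ (-1/2)` on the right half-plane: it is holomorphic
there, its square is `1 / det (1 + z M)`, and at a positive real `z = t` it is the positive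
number `det (1 + t M) ^ (-1/2)`. -/
structure IsInvSqrtDet {n : ℕ} (M : Matrix (Fin n) (Fin n) ℝ) (g : ℂ → ℂ) : Prop where
  differentiableOn : DifferentiableOn ℂ g halfPlane
  sq_mul_det : ∀ z ∈ halfPlane, g z ^ 2 * (1 + z • M.map (fun x : ℝ => (x : ℂ))).det = 1
  ofReal : ∀ t : ℝ, 0 < t → g t = (((1 + t • M).det ^ (-1 / 2 : ℝ) : ℝ) : ℂ)

theorem det_one_add_smul {n : ℕ} {M : Matrix (Fin n) (Fin n) ℝ} (hM : M.IsHermitian) (z : ℂ) :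
    (1 + z • M.map (fun x : ℝ => (x : ℂ))).det = ∏ i, (1 + z * (hM.eigenvalues i : ℂ)) := by
  set U : Matrix (Fin n) (Fin n) ℝ := ↑hM.eigenvectorUnitary with hU
  have h1 : U * star U = 1 := by simp [hU]
  have hs : M = U * Matrix.diagonal hM.eigenvalues * star U := by
    conv_lhs => rw [hM.spectral_theorem, Unitary.conjStarAlgAut_apply]
    rfl
  set f : ℝ →+* ℂ := Complex.ofRealHom
  have h1' : U.map f * (star U).map f = 1 := by
    rw [← Matrix.map_mul, h1, Matrix.map_one _ (map_zero f) (map_one f)]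
  have hs' : M.map (fun x : ℝ => (x : ℂ))
      = U.map f * Matrix.diagonal (fun i => (hM.eigenvalues i : ℂ)) * (star U).map f := by
    have : M.map f = _ := congrArg (fun A : Matrix (Fin n) (Fin n) ℝ => A.map f) hs
    rw [Matrix.map_mul, Matrix.map_mul, Matrix.diagonal_map (map_zero f)] at this
    exact this
  have key : 1 + z • M.map (fun x : ℝ => (x : ℂ))
      = U.map f * Matrix.diagonal (fun i => 1 + z * (hM.eigenvalues i : ℂ)) * (star U).map f := by
    have hd : Matrix.diagonal (fun i => 1 + z * (hM.eigenvalues i : ℂ))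
        = 1 + z • Matrix.diagonal (fun i => (hM.eigenvalues i : ℂ)) := by
      ext i j
      by_cases h : i = j
      · subst h
        simp
      · simp [h]
    rw [hs', hd, Matrix.mul_add, Matrix.add_mul, Matrix.mul_one, h1']
    simp [Matrix.mul_assoc]
  have hdet : (U.map f).det * ((star U).map f).det = 1 := by
    rw [← Matrix.det_mul, h1', Matrix.det_one]
  rw [key, Matrix.det_mul, Matrix.det_mul, Matrix.det_diagonal, mul_right_comm, hdet, one_mul]

/-- The branch exists for every positive semidefinite matrix. -/
theorem exists_isInvSqrtDet {n : ℕ} {M : Matrix (Fin n) (Fin n) ℝ} (hM : M.PosSemidef) :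
    ∃ g, IsInvSqrtDet M g := by
  have h0 := hM.eigenvalues_nonneg
  have hre : ∀ z ∈ halfPlane, ∀ i, 0 < (1 + z * (hM.1.eigenvalues i : ℂ)).re := by
    intro z hz i
    have := mul_nonneg (le_of_lt (show 0 < z.re from hz)) (h0 i)
    simp
    linarith
  refine ⟨fun z => ∏ i, (1 + z * (hM.1.eigenvalues i : ℂ)) ^ (-1 / 2 : ℂ), ?_, ?_, ?_⟩
  · refine DifferentiableOn.fun_finsetProd fun i _ => ?_
    refine DifferentiableOn.cpow (by fun_prop) (by fun_prop) fun z hz => Or.inl (hre z hz i)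
  · intro z hz
    rw [det_one_add_smul hM.1, ← Finset.prod_pow, ← Finset.prod_mul_distrib]
    refine Finset.prod_eq_one fun i _ => ?_
    have hne : 1 + z * (hM.1.eigenvalues i : ℂ) ≠ 0 := fun h => by
      have := hre z hz i
      rw [h] at this
      simp at this
    rw [← Complex.cpow_nat_mul]
    norm_num [Complex.cpow_neg_one, hne]
  · intro t ht
    have hd : (1 + t • M).det = ∏ i, (1 + t * hM.1.eigenvalues i) := by
      have h := det_one_add_smul hM.1 (t : ℂ)
      have hm : (1 + (t : ℂ) • M.map (fun x : ℝ => (x : ℂ)))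
          = (1 + t • M).map Complex.ofRealHom := by
        ext i j
        by_cases hij : i = j
        · subst hij
          simp
        · simp [hij]
      rw [hm, ← RingHom.mapMatrix_apply, ← RingHom.map_det] at h
      apply Complex.ofReal_injective
      rw [Complex.ofRealHom_eq_coe] at h
      rw [h]
      push_cast
      rfl
    have hp : ∀ i, 0 ≤ 1 + t * hM.1.eigenvalues i := fun i => by
      have := mul_nonneg ht.le (h0 i)
      linarith
    rw [hd, ← Real.finsetProd_rpow _ _ (fun i _ => hp i)]
    push_cast
    refine Finset.prod_congr rfl fun i _ => ?_
    rw [Complex.ofReal_cpow (hp i)]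
    push_cast
    rfl

/-- The branch is unique on the half-plane. -/
theorem IsInvSqrtDet.eqOn {n : ℕ} {M : Matrix (Fin n) (Fin n) ℝ} {g h : ℂ → ℂ}
    (hg : IsInvSqrtDet M g) (hh : IsInvSqrtDet M h) : Set.EqOn g h halfPlane := by
  have ho : IsOpen halfPlane := isOpen_lt continuous_const Complex.continuous_re
  have hc : IsPreconnected halfPlane := (convex_halfSpace_re_gt 0).isPreconnected
  have h1 : (1 : ℂ) ∈ halfPlane := by simp [halfPlane]
  refine (hg.differentiableOn.analyticOnNhd ho).eqOn_of_preconnected_of_frequently_eq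
    (hh.differentiableOn.analyticOnNhd ho) hc h1 ?_
  have ht : Tendsto (fun k : ℕ => (((1 : ℝ) + 1 / ((k : ℝ) + 1) : ℝ) : ℂ)) atTop (𝓝[≠] 1) := by
    refine tendsto_nhdsWithin_iff.2 ⟨?_, Eventually.of_forall fun k => ?_⟩
    · have := (tendsto_one_div_add_atTop_nhds_zero_nat (𝕜 := ℝ)).const_add 1
      rw [add_zero] at this
      exact (Complex.continuous_ofReal.tendsto _).comp this
    · have : (0 : ℝ) < 1 / ((k : ℝ) + 1) := by positivity
      intro h
      have h' := congrArg Complex.re (Set.mem_singleton_iff.1 h)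
      rw [Complex.ofReal_re, Complex.one_re] at h'
      linarith
  refine ht.frequently (Eventually.frequently (Eventually.of_forall fun k => ?_))
  have : (0 : ℝ) < 1 + 1 / ((k : ℝ) + 1) := by positivity
  rw [hg.ofReal _ this, hh.ofReal _ this]

/-- `det (1 + z M) ^ (-1/2)` for `Re z > 0`: the value at `z` of the holomorphic branch that is
positive for real positive `z`. (The principal power of the determinant would in general be
discontinuous in `z`.) -/
noncomputable def invSqrtDet {n : ℕ} (M : Matrix (Fin n) (Fin n) ℝ) : ℂ → ℂ :=
  Classical.epsilon (IsInvSqrtDet M)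

theorem isInvSqrtDet_invSqrtDet {n : ℕ} {M : Matrix (Fin n) (Fin n) ℝ} (hM : M.PosSemidef) :
    IsInvSqrtDet M (invSqrtDet M) :=
  Classical.epsilon_spec (exists_isInvSqrtDet hM)

/-- The random points `ξ 0, ξ 1, …` form a Poisson point process on the real line with (infinite)
intensity measure `ρ`: for finitely many pairwise disjoint Borel sets of finite intensity, the
numbers of points in these sets are independent Poisson random variables whose parameters are the
intensities of the sets. -/
structure IsPoissonProcess {Ω : Type*} [MeasurableSpace Ω] (P : Measure Ω) (ρ : Measure ℝ)
    (ξ : ℕ → Ω → ℝ) : Prop where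
  measurable : ∀ i, Measurable (ξ i)
  counts : ∀ (r : ℕ) (B : Fin r → Set ℝ), (∀ l, MeasurableSet (B l)) → (∀ l, ρ (B l) ≠ ⊤) →
    Pairwise (fun l l' => Disjoint (B l) (B l')) → ∀ k : Fin r → ℕ,
      P {ω | ∀ l, {i | ξ i ω ∈ B l}.encard = k l}
        = ∏ l, poissonMeasure (ρ (B l)).toNNReal {k l}

/-- The measure on the positive half-axis with density `1 / (π x ^ (3/2))`. -/
noncomputable def intensity : Measure ℝ :=
  (volume.restrict (Set.Ioi 0)).withDensity
    fun x => ENNReal.ofReal (1 / (Real.pi * x ^ (3 / 2 : ℝ)))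

end CauchyMatrix

/-! An inverse square root of a determinant is a Gaussian integral. For independent standard
Gaussian vectors `g`, `h` and real `s ≥ 0`, `det (1 + s² ΓᵀΓ)^(-1/2) = E exp (-s² |Γg|² / 2) = E exp
(i s ⟨h, Γg⟩)`. The last exponent is linear in the entries of `Γ`, and the Cauchy characteristic
function is `exp (-|t|)`, so averaging over the entries leaves `E exp (-s ∑ q_jk |h_j| |g_k|)`
(`integral_cauchyPi_det_rpow`). With `s = √z / (m b)` both sides are holomorphic in `z`, and the
identity extends from `z > 0` to the half-plane (`integral_cauchyPi_invSqrtDet`).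

The normalized form `X = ∑ q_jk |h_j| |g_k| / (m b)` has mean `2/π`, because `(E|g|)² = 2/π` and `Q`
contains `m b` ones. Two of its terms are correlated only if they share a row or a column, so its
variance is at most `1/m + 1/b ≤ 2/b` (`integral_absForm_div_sub_sq_le`). Since `x ↦ exp (-w x)` is
`‖w‖`-Lipschitz on `[0, ∞)` when `Re w > 0`, part (1) holds with error `3 |√z| / √b`. For real `w =
t` the first-order term at the mean cancels, and the bounds of `integral_exp_neg_mul_bounds` give a
relative error `O(1/b)` in the exponent, locally uniformly in `t`; this implies (3).

Part (2) involves no matrices. It is the product formula `E ∏ f(x_i) = exp (-∫ (1 - f) dρ)` for a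
Poisson process (`IsPoissonProcess.integral_tprod`), with the integral evaluated by the explicit
antiderivative `(2/π) (√(1 + z x) - 1) / √x` (`integral_Ioi_intensityDensity_smul`). -/

namespace CauchyMatrix

/-! ### Poisson processes: counts, intensity and the product formula -/

theorem integral_pow_poissonMeasure (r : NNReal) (v : ℂ) :
    ∫ k, v ^ k ∂(poissonMeasure r) = Complex.exp (-(r * (1 - v))) := by
  rw [integral_poissonMeasure]
  calc ∑' a : ℕ, (Real.exp (-r) * r ^ a / a.factorial : ℝ) • v ^ a
      = ∑' a : ℕ, (Real.exp (-r) : ℂ) * ((r * v) ^ a / a.factorial) := by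
        congr with a
        rw [Complex.real_smul, mul_pow]
        push_cast
        ring
    _ = (Real.exp (-r) : ℂ) * Complex.exp (r * v) := by
        rw [tsum_mul_left, (NormedSpace.expSeries_div_hasSum_exp ((r : ℂ) * v)).tsum_eq,
          Complex.exp_eq_exp_ℂ]
    _ = _ := by
        rw [Complex.ofReal_exp, ← Complex.exp_add]
        push_cast
        ring_nf

theorem lintegral_natCast_poissonMeasure (r : NNReal) :
    ∫⁻ k, (k : ENNReal) ∂(poissonMeasure r) = r := by
  have hs : HasSum (fun n : ℕ => (Real.exp (-r) * r ^ n / n.factorial) * n) r := by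
    have h := (hasSum_one_poissonMeasure r).mul_right (r : ℝ)
    rw [one_mul] at h
    -- The term at `0` vanishes, and the shifted series is `r` times the total mass.
    rw [← hasSum_nat_add_iff' 1]
    simp only [Finset.range_one, Finset.sum_singleton, Nat.cast_zero, mul_zero, sub_zero]
    refine (congrArg (HasSum · (r : ℝ)) (funext fun n => ?_)).mpr h
    rw [Nat.factorial_succ]
    have : (n.factorial : ℝ) ≠ 0 := by positivity
    push_cast
    field_simp
    exact pow_succ' _ _
  rw [lintegral_countable']
  have h0 : ∀ n : ℕ, 0 ≤ (Real.exp (-r) * r ^ n / n.factorial) * n := fun n => by positivity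
  rw [← ENNReal.ofReal_coe_nnreal, ← hs.tsum_eq, ENNReal.ofReal_tsum_of_nonneg h0 hs.summable]
  congr with n
  rw [poissonMeasure_singleton, mul_comm, ENNReal.ofReal_mul (by positivity), ENNReal.ofReal_natCast]

section Poisson

variable {Ω : Type*} [MeasurableSpace Ω] {P : Measure Ω} {ρ : Measure ℝ} {ξ : ℕ → Ω → ℝ}

theorem tsum_indicator_one_eq_encard {α : Type*} (x : ℕ → α) (B : Set α) :
    ∑' i, B.indicator (1 : α → ENNReal) (x i) = (({i | x i ∈ B}.encard : ENat) : ENNReal) := by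
  rw [← ENNReal.tsum_set_one, tsum_subtype {i | x i ∈ B} fun _ => (1 : ENNReal)]
  rfl

theorem IsPoissonProcess.measurable_encard (hξ : IsPoissonProcess P ρ ξ) {B : Set ℝ}
    (hB : MeasurableSet B) : Measurable fun ω => ({i | ξ i ω ∈ B}.encard : ENat) := by
  have h1 : Measurable fun ω => ∑' i, B.indicator (1 : ℝ → ENNReal) (ξ i ω) :=
    Measurable.tsum fun i => (measurable_one.indicator hB).comp (hξ.measurable i)
  simp_rw [tsum_indicator_one_eq_encard] at h1
  -- `ENat` is countable, so preimages of singletons suffice; they can be tested after the injection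
  -- into `ENNReal`.
  refine measurable_to_countable' fun k => ?_
  convert h1 (measurableSet_singleton (k : ENNReal)) using 1
  ext ω
  simp

/-- The axiom prescribes the probabilities of finite count vectors only. They already add up to `1`,
the mass of a product of Poisson laws, so infinite counts have probability zero and `ncard` loses no
information. -/
theorem IsPoissonProcess.map_counts (hξ : IsPoissonProcess P ρ ξ) [IsProbabilityMeasure P] {r : ℕ}
    {B : Fin r → Set ℝ} (hB : ∀ l, MeasurableSet (B l)) (hB' : ∀ l, ρ (B l) ≠ ⊤)
    (hd : Pairwise fun l l' => Disjoint (B l) (B l')) :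
    (∀ᵐ ω ∂P, ∀ l, {i | ξ i ω ∈ B l}.Finite) ∧
    P.map (fun ω l => {i | ξ i ω ∈ B l}.ncard)
      = Measure.pi fun l => poissonMeasure (ρ (B l)).toNNReal := by
  have hm : ∀ k : Fin r → ℕ, MeasurableSet {ω | ∀ l, {i | ξ i ω ∈ B l}.encard = k l} := by
    intro k
    rw [Set.ofPred_forall]
    exact MeasurableSet.iInter fun l => hξ.measurable_encard (hB l) (measurableSet_singleton _)
  have hfin : ∀ᵐ ω ∂P, ∀ l, {i | ξ i ω ∈ B l}.Finite := by
    have h1 : P (⋃ k : Fin r → ℕ, {ω | ∀ l, {i | ξ i ω ∈ B l}.encard = k l}) = 1 := by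
      rw [measure_iUnion _ hm]
      · simp_rw [hξ.counts r B hB hB' hd, ← Measure.pi_singleton]
        rw [← measure_iUnion _ (fun _ => measurableSet_singleton _)]
        · rw [Set.iUnion_of_singleton, measure_univ]
        · intro k k' hk
          simpa using hk
      · intro k k' hk
        refine Set.disjoint_left.2 fun ω h h' => hk (funext fun l => ?_)
        have := (h l).symm.trans (h' l)
        exact_mod_cast this
    filter_upwards [(prob_compl_eq_zero_iff (MeasurableSet.iUnion hm)).2 h1] with ω hω l
    simp only [Set.mem_iUnion, Set.mem_ofPred_eq] at hω
    obtain ⟨k, hk⟩ := hω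
    exact Set.finite_of_encard_eq_coe (hk l)
  have hmn : Measurable fun ω (l : Fin r) => {i | ξ i ω ∈ B l}.ncard :=
    measurable_pi_lambda _ fun l =>
      (Measurable.of_discrete (f := ENat.toNat)).comp (hξ.measurable_encard (hB l))
  refine ⟨hfin, Measure.ext_of_singleton fun k => ?_⟩
  rw [Measure.map_apply hmn (measurableSet_singleton _), Measure.pi_singleton,
    ← hξ.counts r B hB hB' hd k]
  refine measure_congr ?_
  filter_upwards [hfin] with ω hω
  refine propext ?_
  change (_ = k) ↔ ∀ l, _
  rw [funext_iff]
  refine forall_congr' fun l => ?_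
  rw [← (hω l).cast_ncard_eq]
  exact Nat.cast_inj.symm

/-- Both sides are the expected number of points in `B`: the left by summing indicators, the right
as the mean of a Poisson variable. -/
theorem IsPoissonProcess.tsum_measure (hξ : IsPoissonProcess P ρ ξ) [IsProbabilityMeasure P]
    {B : Set ℝ} (hB : MeasurableSet B) (hB' : ρ B ≠ ⊤) :
    ∑' i, P (ξ i ⁻¹' B) = ρ B := by
  obtain ⟨hf, hmap⟩ := hξ.map_counts (r := 1) (B := fun _ => B) (fun _ => hB) (fun _ => hB')
    (fun l l' h => absurd (Subsingleton.elim l l') h)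
  have hmn : Measurable fun ω (l : Fin 1) => {i | ξ i ω ∈ B}.ncard :=
    measurable_pi_lambda _ fun l =>
      (Measurable.of_discrete (f := ENat.toNat)).comp (hξ.measurable_encard hB)
  calc ∑' i, P (ξ i ⁻¹' B) = ∑' i, ∫⁻ ω, B.indicator (1 : ℝ → ENNReal) (ξ i ω) ∂P := by
        congr with i
        rw [← lintegral_indicator_one (hξ.measurable i hB)]
        rfl
    _ = ∫⁻ ω, ∑' i, B.indicator (1 : ℝ → ENNReal) (ξ i ω) ∂P :=
        (lintegral_tsum fun i =>
          ((measurable_one.indicator hB).comp (hξ.measurable i)).aemeasurable).symm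
    _ = ∫⁻ ω, (({i | ξ i ω ∈ B}.ncard : ℕ) : ENNReal) ∂P := by
        refine lintegral_congr_ae ?_
        filter_upwards [hf] with ω hω
        rw [tsum_indicator_one_eq_encard, ← (hω 0).cast_ncard_eq]
        rfl
    _ = ∫⁻ k : Fin 1 → ℕ, ((k 0 : ℕ) : ENNReal)
          ∂(P.map fun ω (_ : Fin 1) => {i | ξ i ω ∈ B}.ncard) := by
        rw [lintegral_map .of_discrete hmn]
    _ = ∫⁻ k, (k : ENNReal) ∂(poissonMeasure (ρ B).toNNReal) := by
        rw [hmap]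
        exact (measurePreserving_eval (fun _ : Fin 1 => poissonMeasure (ρ B).toNNReal) 0).lintegral_comp
          (f := fun k : ℕ => (k : ENNReal)) .of_discrete
    _ = ρ B := by rw [lintegral_natCast_poissonMeasure, ENNReal.coe_toNNReal hB']

/-- This turns statements about `ρ` into statements about the points: null sets are almost surely
avoided, and integrable functions are almost surely summable along the process. -/
theorem IsPoissonProcess.sum_map (hξ : IsPoissonProcess P ρ ξ) [IsProbabilityMeasure P]
    [SigmaFinite ρ] : Measure.sum (fun i => P.map (ξ i)) = ρ := by
  have key : ∀ B, MeasurableSet B → ρ B ≠ ⊤ → Measure.sum (fun i => P.map (ξ i)) B = ρ B := by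
    intro B hB hB'
    rw [Measure.sum_apply _ hB, ← hξ.tsum_measure hB hB']
    congr with i
    rw [Measure.map_apply (hξ.measurable i) hB]
  ext B hB
  have hU : B = ⋃ k, B ∩ spanningSets ρ k := by
    rw [← Set.inter_iUnion, iUnion_spanningSets, Set.inter_univ]
  have hmono : Monotone fun k => B ∩ spanningSets ρ k := fun i j h =>
    Set.inter_subset_inter_right _ (monotone_spanningSets ρ h)
  rw [hU, hmono.measure_iUnion, hmono.measure_iUnion]
  congr with k
  exact key _ (hB.inter (measurableSet_spanningSets ρ k))
    ((measure_mono Set.inter_subset_right).trans_lt (measure_spanningSets_lt_top ρ k)).ne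

theorem IsPoissonProcess.ae_forall (hξ : IsPoissonProcess P ρ ξ) [IsProbabilityMeasure P]
    [SigmaFinite ρ] {p : ℝ → Prop} (hp : ∀ᵐ x ∂ρ, p x) : ∀ᵐ ω ∂P, ∀ i, p (ξ i ω) := by
  rw [← hξ.sum_map, Measure.ae_sum_iff] at hp
  exact ae_all_iff.2 fun i => ae_of_ae_map (hξ.measurable i).aemeasurable (hp i)

theorem IsPoissonProcess.ae_summable_norm (hξ : IsPoissonProcess P ρ ξ) [IsProbabilityMeasure P]
    [SigmaFinite ρ] {f : ℝ → ℂ} (hf : Measurable f) (hi : Integrable f ρ) :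
    ∀ᵐ ω ∂P, Summable fun i => ‖f (ξ i ω)‖ := by
  have h : ∫⁻ ω, ∑' i, ‖f (ξ i ω)‖ₑ ∂P ≠ ⊤ := by
    have h2 := hi.2.ne
    rw [← hξ.sum_map, lintegral_sum_measure] at h2
    rw [lintegral_tsum (f := fun i ω => ‖f (ξ i ω)‖ₑ)
      fun i => (hf.enorm.comp (hξ.measurable i)).aemeasurable]
    convert h2 using 3 with i
    rw [lintegral_map hf.enorm (hξ.measurable i)]
  filter_upwards [ae_lt_top (Measurable.tsum fun i =>
    hf.enorm.comp (hξ.measurable i)) h] with ω hω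
  have := ENNReal.summable_toReal hω.ne
  simpa using this

theorem IsPoissonProcess.integral_prod_pow_ncard (hξ : IsPoissonProcess P ρ ξ)
    [IsProbabilityMeasure P] {ι : Type*} [Fintype ι]
    {B : ι → Set ℝ} (hB : ∀ l, MeasurableSet (B l)) (hB' : ∀ l, ρ (B l) ≠ ⊤)
    (hd : Pairwise fun l l' => Disjoint (B l) (B l')) (v : ι → ℂ) :
    (∀ᵐ ω ∂P, ∀ l, {i | ξ i ω ∈ B l}.Finite) ∧
    ∫ ω, ∏ l, v l ^ {i | ξ i ω ∈ B l}.ncard ∂P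
      = Complex.exp (-∑ l, (ρ (B l)).toReal * (1 - v l)) := by
  set e := (Fintype.equivFin ι).symm
  obtain ⟨hf, hmap⟩ := hξ.map_counts (B := B ∘ e) (fun l => hB _) (fun l => hB' _)
    (fun l l' h => hd (e.injective.ne h))
  have hmn : Measurable fun ω (l : Fin (Fintype.card ι)) => {i | ξ i ω ∈ (B ∘ e) l}.ncard :=
    measurable_pi_lambda _ fun l =>
      (Measurable.of_discrete (f := ENat.toNat)).comp (hξ.measurable_encard (hB _))
  refine ⟨?_, ?_⟩
  · filter_upwards [hf] with ω hω l
    simpa using hω (e.symm l)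
  calc ∫ ω, ∏ l, v l ^ {i | ξ i ω ∈ B l}.ncard ∂P
      = ∫ ω, ∏ l, v (e l) ^ {i | ξ i ω ∈ (B ∘ e) l}.ncard ∂P := by
        congr with ω
        exact (e.prod_comp fun l => v l ^ {i | ξ i ω ∈ B l}.ncard).symm
    _ = ∫ k : Fin (Fintype.card ι) → ℕ, ∏ l, v (e l) ^ k l
          ∂(P.map fun ω l => {i | ξ i ω ∈ (B ∘ e) l}.ncard) := by
        rw [integral_map hmn.aemeasurable
          (Measurable.of_discrete.aestronglyMeasurable)]
    _ = ∏ l, ∫ k, v (e l) ^ k ∂(poissonMeasure (ρ ((B ∘ e) l)).toNNReal) := by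
        rw [hmap]
        exact integral_fintype_prod_eq_prod (fun l (k : ℕ) => v (e l) ^ k)
    _ = ∏ l, Complex.exp (-((ρ (B l)).toReal * (1 - v l))) := by
        simp_rw [integral_pow_poissonMeasure]
        exact e.prod_comp fun l => Complex.exp (-((ρ (B l)).toReal * (1 - v l)))
    _ = _ := by rw [← Complex.exp_sum, Finset.sum_neg_distrib]

end Poisson

theorem norm_tprod_le_one {ι : Type*} {u : ι → ℂ} (hu : ∀ i, ‖u i‖ ≤ 1) : ‖∏' i, u i‖ ≤ 1 := by
  by_cases h : Multipliable u
  · refine le_of_tendsto h.hasProd.norm (Eventually.of_forall fun s => ?_)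
    exact Finset.prod_le_one (fun i _ => norm_nonneg _) fun i _ => hu i
  -- A product that does not converge has the default value `1`, which respects the bound.
  · simp [tprod_eq_one_of_not_multipliable h]

section Poisson

variable {Ω : Type*} [MeasurableSpace Ω] {P : Measure Ω} [IsProbabilityMeasure P] {ρ : Measure ℝ}
  {ξ : ℕ → Ω → ℝ}

/-- Grouping the points by the value of `g` turns the product into `∏ v ^ N_v` with independent
Poisson counts `N_v`, whose generating functions are known. -/
theorem IsPoissonProcess.integral_tprod_simpleFunc (hξ : IsPoissonProcess P ρ ξ)
    (g : SimpleFunc ℝ ℂ) (hg : Integrable (fun x => 1 - g x) ρ) :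
    ∫ ω, ∏' i, g (ξ i ω) ∂P = Complex.exp (-∫ x, (1 - g x) ∂ρ) := by
  -- The value `1` is left out: its level set may have infinite intensity, but it contributes
  -- nothing to the product or to the integral.
  set S : Finset ℂ := g.range.erase 1 with hS
  have hmem : ∀ x, g x ∈ S ↔ g x ≠ 1 := fun x => by simp [hS]
  have hB : ∀ v : S, MeasurableSet (g ⁻¹' {(v : ℂ)}) := fun v => g.measurableSet_fiber _
  have hB' : ∀ v : S, ρ (g ⁻¹' {(v : ℂ)}) ≠ ⊤ := fun v => by
    have h := SimpleFunc.measure_preimage_lt_top_of_integrable (SimpleFunc.const ℝ (1 : ℂ) - g) hg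
      (x := 1 - v) (sub_ne_zero.2 (Finset.ne_of_mem_erase v.2).symm)
    convert h.ne using 2
    ext x
    simp
  have hd : Pairwise fun v w : S => Disjoint (g ⁻¹' {(v : ℂ)}) (g ⁻¹' {(w : ℂ)}) := fun v w h =>
    Disjoint.preimage _ (Set.disjoint_singleton.2 (Subtype.coe_injective.ne h))
  obtain ⟨hf, hint⟩ := hξ.integral_prod_pow_ncard hB hB' hd (fun v => (v : ℂ))
  have hsum : ∫ x, (1 - g x) ∂ρ = ∑ v : S, (ρ (g ⁻¹' {(v : ℂ)})).toReal * (1 - (v : ℂ)) := by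
    have : ∀ x, 1 - g x = ∑ v : S, (g ⁻¹' {(v : ℂ)}).indicator (fun _ => 1 - (v : ℂ)) x := by
      intro x
      rw [Finset.sum_coe_sort S fun v => (g ⁻¹' {v}).indicator (fun _ => 1 - v) x]
      simp only [Set.indicator, Set.mem_preimage, Set.mem_singleton_iff]
      rw [Finset.sum_ite_eq]
      split_ifs with h
      · rfl
      · rw [not_not.1 ((hmem x).not.1 h), sub_self]
    simp_rw [this]
    rw [integral_finsetSum _ fun v _ =>
      (integrable_indicator_iff (hB v)).2 (integrableOn_const (hB' v))]
    refine Finset.sum_congr rfl fun v _ => ?_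
    rw [integral_indicator_const _ (hB v), Complex.real_smul]
    rfl
  rw [hsum, ← hint]
  refine integral_congr_ae ?_
  filter_upwards [hf] with ω hω
  have hprod : ∀ x, g x = ∏ v : S, if g x = v then (v : ℂ) else 1 := by
    intro x
    rw [Finset.prod_coe_sort S fun v => if g x = v then v else 1, Finset.prod_ite_eq]
    split_ifs with h
    · rfl
    · exact not_not.1 ((hmem x).not.1 h)
  have h1 : ∀ (v : S), ∀ i ∉ (hω v).toFinset, (if g (ξ i ω) = v then (v : ℂ) else 1) = 1 := by
    intro v i hi
    rw [if_neg]
    simpa using hi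
  calc ∏' i, g (ξ i ω) = ∏' i, ∏ v : S, if g (ξ i ω) = v then (v : ℂ) else 1 :=
        tprod_congr fun i => hprod _
    _ = ∏ v : S, ∏' i, if g (ξ i ω) = v then (v : ℂ) else 1 :=
        Multipliable.tprod_finsetProd fun v _ => multipliable_of_ne_finset_one (h1 v)
    _ = _ := by
        refine Finset.prod_congr rfl fun v _ => ?_
        rw [tprod_eq_prod (h1 v), Set.ncard_eq_toFinset_card _ (hω v), ← Finset.prod_const]
        refine Finset.prod_congr rfl fun i hi => if_pos ?_
        simpa using hi

theorem IsPoissonProcess.ae_multipliable (hξ : IsPoissonProcess P ρ ξ) [SigmaFinite ρ]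
    {f : ℝ → ℂ} (hf : Measurable f) (hi : Integrable (fun x => 1 - f x) ρ) :
    ∀ᵐ ω ∂P, Multipliable fun i => f (ξ i ω) := by
  filter_upwards [hξ.ae_summable_norm (measurable_const.sub hf) hi] with ω hω
  have h := multipliable_one_add_of_summable (f := fun i => f (ξ i ω) - 1)
    (by simpa [norm_sub_rev] using hω)
  simpa using h

theorem IsPoissonProcess.aestronglyMeasurable_tprod (hξ : IsPoissonProcess P ρ ξ) [SigmaFinite ρ]
    {f : ℝ → ℂ} (hf : Measurable f) (hi : Integrable (fun x => 1 - f x) ρ) :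
    AEStronglyMeasurable (fun ω => ∏' i, f (ξ i ω)) P := by
  refine aestronglyMeasurable_of_tendsto_ae atTop
    (f := fun (N : ℕ) ω => ∏ i ∈ Finset.range N, f (ξ i ω)) (fun N => ?_) ?_
  · exact (Finset.measurable_fun_prod _ fun i _ =>
      hf.comp (hξ.measurable i)).aestronglyMeasurable
  · filter_upwards [hξ.ae_multipliable hf hi] with ω hω
    exact hω.hasProd.tendsto_prod_nat

/-- Simple functions approximate `f`, and dominated convergence applies twice: to the infinite
products, bounded by `1`, and to the integrals in the exponent. -/
theorem IsPoissonProcess.integral_tprod (hξ : IsPoissonProcess P ρ ξ) [SigmaFinite ρ]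
    {f : ℝ → ℂ} (hf : Measurable f) (hf1 : ∀ x, ‖f x‖ ≤ 1)
    (hi : Integrable (fun x => 1 - f x) ρ) :
    ∫ ω, ∏' i, f (ξ i ω) ∂P = Complex.exp (-∫ x, (1 - f x) ∂ρ) := by
  have hone : (1 : ℂ) ∈ Metric.closedBall (0 : ℂ) 1 := by simp
  set g : ℕ → SimpleFunc ℝ ℂ := SimpleFunc.approxOn f hf (Metric.closedBall 0 1) 1 hone with hg
  have hlim : ∀ x, Tendsto (fun k => g k x) atTop (𝓝 (f x)) := fun x =>
    SimpleFunc.tendsto_approxOn hf hone (subset_closure (by simpa using hf1 x))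
  have hg1 : ∀ k x, ‖g k x‖ ≤ 1 := fun k x => by
    simpa using SimpleFunc.approxOn_mem hf hone k x
  -- Taking `1` as base point of `approxOn` is what gives domination by `1 - f`, uniformly in `k`.
  have hbd : ∀ k x, ‖1 - g k x‖ ≤ 2 * ‖1 - f x‖ := fun k x => by
    have := SimpleFunc.norm_approxOn_y₀_le hf hone x k
    rw [norm_sub_rev, norm_sub_rev 1 (f x)]
    linarith
  have hgi : ∀ k, Integrable (fun x => 1 - g k x) ρ := fun k =>
    (hi.norm.const_mul 2).mono' (measurable_const.sub (g k).measurable).aestronglyMeasurable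
      (Eventually.of_forall (hbd k))
  have h1 : Tendsto (fun k => ∫ ω, ∏' i, g k (ξ i ω) ∂P) atTop (𝓝 (∫ ω, ∏' i, f (ξ i ω) ∂P)) := by
    refine tendsto_integral_of_dominated_convergence (fun _ => 1)
      (fun k => hξ.aestronglyMeasurable_tprod (g k).measurable (hgi k)) (integrable_const _)
      (fun k => Eventually.of_forall fun ω => norm_tprod_le_one fun i => hg1 k _) ?_
    filter_upwards [hξ.ae_summable_norm (measurable_const.sub hf) hi] with ω hω
    have := tendsto_tprod_one_add_of_dominated_convergence (𝓕 := atTop)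
      (f := fun k i => g k (ξ i ω) - 1) (g := fun i => f (ξ i ω) - 1) (hω.mul_left 2)
      (fun i => (hlim _).sub_const 1)
      (Eventually.of_forall fun k i => by simpa [norm_sub_rev] using hbd k (ξ i ω))
    simpa using this
  have h2 : Tendsto (fun k => Complex.exp (-∫ x, (1 - g k x) ∂ρ)) atTop
      (𝓝 (Complex.exp (-∫ x, (1 - f x) ∂ρ))) := by
    refine (Complex.continuous_exp.tendsto _).comp (Tendsto.neg ?_)
    exact tendsto_integral_of_dominated_convergence (fun x => 2 * ‖1 - f x‖)
      (fun k => (hgi k).1) (hi.norm.const_mul 2) (fun k => Eventually.of_forall (hbd k))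
      (Eventually.of_forall fun x => (hlim x).const_sub 1)
  simp_rw [fun k => hξ.integral_tprod_simpleFunc (g k) (hgi k)] at h1
  exact tendsto_nhds_unique h1 h2

end Poisson

/-! ### Square roots on the half-plane and the exponent integral -/

theorem re_cpow_half_pos {w : ℂ} (hw : 0 < w.re) : 0 < (w ^ (1 / 2 : ℂ)).re := by
  have hw0 : w ≠ 0 := fun h => by simp [h] at hw
  have him : (Complex.log w * (1 / 2)).im = w.arg / 2 := by
    simp [Complex.mul_im, Complex.log_im]
    ring
  have h := abs_lt.1 (Complex.abs_arg_lt_pi_div_two_iff.2 (Or.inl hw))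
  rw [Complex.cpow_def_of_ne_zero hw0, Complex.exp_re, him]
  have := Real.pi_pos
  exact mul_pos (Real.exp_pos _) (Real.cos_pos_of_mem_Ioo ⟨by linarith, by linarith⟩)

theorem cpow_half_sq (w : ℂ) : (w ^ (1 / 2 : ℂ)) ^ 2 = w := by
  rw [one_div]
  exact Complex.cpow_ofNat_inv_pow w 2

theorem cpow_half_of_sq {w : ℂ} (hw : 0 < w.re) : (w ^ 2) ^ (1 / 2 : ℂ) = w := by
  rw [one_div]
  exact Complex.sq_cpow_two_inv hw

theorem cpow_neg_half (w : ℂ) : w ^ (-1 / 2 : ℂ) = (w ^ (1 / 2 : ℂ))⁻¹ := by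
  rw [neg_div, Complex.cpow_neg]

theorem one_le_re_one_add_mul {z : ℂ} (hz : z ∈ halfPlane) {x : ℝ} (hx : 0 ≤ x) :
    1 ≤ (1 + z * x).re := by
  have := mul_nonneg (le_of_lt (show 0 < z.re from hz)) hx
  simpa using this

theorem one_le_norm_cpow_half {w : ℂ} (hw : 1 ≤ w.re) : 1 ≤ ‖w ^ (1 / 2 : ℂ)‖ := by
  have h : 1 ≤ ‖(w ^ (1 / 2 : ℂ)) ^ 2‖ := by
    rw [cpow_half_sq]
    exact hw.trans (Complex.re_le_norm w)
  rw [norm_pow] at h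
  exact (one_le_pow_iff_of_nonneg (norm_nonneg _) two_ne_zero).1 h

theorem norm_cpow_neg_half_le_one {z : ℂ} (hz : z ∈ halfPlane) {x : ℝ} (hx : 0 ≤ x) :
    ‖(1 + z * x) ^ (-1 / 2 : ℂ)‖ ≤ 1 := by
  rw [cpow_neg_half, norm_inv]
  exact inv_le_one_of_one_le₀ (one_le_norm_cpow_half (one_le_re_one_add_mul hz hx))

theorem norm_cpow_half_sub_one_le {z : ℂ} (hz : z ∈ halfPlane) {x : ℝ} (hx : 0 ≤ x) :
    ‖(1 + z * x) ^ (1 / 2 : ℂ) - 1‖ ≤ ‖z‖ * x := by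
  have h1 := one_le_re_one_add_mul hz hx
  set s := (1 + z * x) ^ (1 / 2 : ℂ) with hs
  have hsq : s ^ 2 = 1 + z * x := cpow_half_sq _
  have hre : 0 < s.re := re_cpow_half_pos (by linarith)
  have h2 : 1 ≤ ‖s + 1‖ := le_trans (by simpa using hre.le) (Complex.re_le_norm (s + 1))
  -- With `s = √(1 + z x)`, `(s - 1)(s + 1) = z x` and the second factor has norm at least `1`.
  have h3 : ‖s - 1‖ * ‖s + 1‖ = ‖z‖ * x := by
    rw [← norm_mul, show (s - 1) * (s + 1) = z * x by linear_combination hsq, norm_mul,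
      Complex.norm_of_nonneg hx]
  nlinarith [norm_nonneg (s - 1)]

theorem norm_one_sub_cpow_neg_half_le {z : ℂ} (hz : z ∈ halfPlane) {x : ℝ} (hx : 0 ≤ x) :
    ‖1 - (1 + z * x) ^ (-1 / 2 : ℂ)‖ ≤ ‖z‖ * x := by
  have h1 := one_le_norm_cpow_half (one_le_re_one_add_mul hz hx)
  have h0 : (1 + z * x) ^ (1 / 2 : ℂ) ≠ 0 := fun h => by
    rw [h, norm_zero] at h1
    linarith
  have h2 := norm_cpow_half_sub_one_le hz hx
  rw [cpow_neg_half, show 1 - ((1 + z * x) ^ (1 / 2 : ℂ))⁻¹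
    = ((1 + z * x) ^ (1 / 2 : ℂ) - 1) / (1 + z * x) ^ (1 / 2 : ℂ) by field_simp, norm_div]
  exact (div_le_self (norm_nonneg _) h1).trans h2

/-- The density of `intensity` on the positive half-axis. -/
noncomputable def intensityDensity (x : ℝ) : ℝ := 1 / (Real.pi * x ^ (3 / 2 : ℝ))

theorem measurable_intensityDensity : Measurable intensityDensity := by
  unfold intensityDensity
  fun_prop

theorem intensity_eq : intensity = (volume.restrict (Set.Ioi 0)).withDensity
    fun x => ENNReal.ofReal (intensityDensity x) := rfl

instance : SigmaFinite intensity := by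
  rw [intensity_eq]
  exact SigmaFinite.withDensity_ofReal _

theorem ae_intensity_pos : ∀ᵐ x ∂intensity, 0 < x :=
  (withDensity_absolutelyContinuous _ _).ae_le (ae_restrict_mem measurableSet_Ioi)

theorem toReal_ofReal_intensityDensity {x : ℝ} (hx : 0 < x) :
    (ENNReal.ofReal (intensityDensity x)).toReal = intensityDensity x :=
  ENNReal.toReal_ofReal (by unfold intensityDensity; positivity)

theorem integral_intensity (f : ℝ → ℂ) :
    ∫ x, f x ∂intensity = ∫ x in Set.Ioi 0, intensityDensity x • f x := by
  rw [intensity_eq, integral_withDensity_eq_integral_toReal_smul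
    measurable_intensityDensity.ennreal_ofReal (by simp)]
  refine setIntegral_congr_fun measurableSet_Ioi fun x hx => ?_
  simp only [toReal_ofReal_intensityDensity hx]

theorem integrable_intensity_iff (f : ℝ → ℂ) :
    Integrable f intensity ↔ IntegrableOn (fun x => intensityDensity x • f x) (Set.Ioi 0) := by
  rw [intensity_eq, integrable_withDensity_iff_integrable_smul'
    measurable_intensityDensity.ennreal_ofReal (by simp)]
  refine integrableOn_congr_fun (fun x hx => ?_) measurableSet_Ioi
  simp only [toReal_ofReal_intensityDensity hx]

theorem measurable_cpow_neg_half (z : ℂ) :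
    Measurable fun x : ℝ => (1 + z * x) ^ (-1 / 2 : ℂ) := by
  fun_prop

/-- Near `0` the bracket is `O(x)`, which leaves `x ^ (-1/2)`; beyond `1` it is bounded by `2`,
which leaves `x ^ (-3/2)`. -/
theorem integrableOn_intensityDensity_smul {z : ℂ} (hz : z ∈ halfPlane) :
    IntegrableOn (fun x : ℝ => intensityDensity x • (1 - (1 + z * x) ^ (-1 / 2 : ℂ)))
      (Set.Ioi 0) := by
  have hm : Measurable fun x : ℝ => intensityDensity x • (1 - (1 + z * x) ^ (-1 / 2 : ℂ)) :=
    measurable_intensityDensity.smul (measurable_const.sub (measurable_cpow_neg_half z))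
  have hn : ∀ x : ℝ, 0 < x → ‖intensityDensity x • (1 - (1 + z * x) ^ (-1 / 2 : ℂ))‖
      = Real.pi⁻¹ * x ^ (-(3 / 2) : ℝ) * ‖1 - (1 + z * x) ^ (-1 / 2 : ℂ)‖ := by
    intro x hx
    have : 0 ≤ intensityDensity x := by unfold intensityDensity; positivity
    rw [norm_smul, Real.norm_of_nonneg this, intensityDensity, Real.rpow_neg hx.le]
    field_simp
  rw [← Set.Ioc_union_Ioi_eq_Ioi zero_le_one]
  refine IntegrableOn.union ?_ ?_
  · have h : IntegrableOn (fun x : ℝ => Real.pi⁻¹ * ‖z‖ * x ^ (-(1 / 2) : ℝ)) (Set.Ioc 0 1) := by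
      have := (intervalIntegral.intervalIntegrable_rpow' (a := 0) (b := 1)
        (r := -(1 / 2)) (by norm_num)).const_mul (Real.pi⁻¹ * ‖z‖)
      rwa [intervalIntegrable_iff_integrableOn_Ioc_of_le zero_le_one] at this
    refine h.mono' hm.aestronglyMeasurable ?_
    refine (ae_restrict_iff' measurableSet_Ioc).2 (Eventually.of_forall fun x hx => ?_)
    rw [hn x hx.1]
    have h1 := norm_one_sub_cpow_neg_half_le hz hx.1.le
    have h2 : x ^ (-(1 / 2) : ℝ) = x ^ (-(3 / 2) : ℝ) * x := by
      rw [← Real.rpow_add_one hx.1.ne']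
      norm_num
    have hx0 := hx.1
    calc _ ≤ Real.pi⁻¹ * x ^ (-(3 / 2) : ℝ) * (‖z‖ * x) := by gcongr
      _ = _ := by rw [h2]; ring
  · have h : IntegrableOn (fun x : ℝ => Real.pi⁻¹ * x ^ (-(3 / 2) : ℝ) * 2) (Set.Ioi 1) :=
      ((integrableOn_Ioi_rpow_of_lt (by norm_num) one_pos).const_mul _).mul_const _
    refine h.mono' hm.aestronglyMeasurable ?_
    refine (ae_restrict_iff' measurableSet_Ioi).2 (Eventually.of_forall fun x hx => ?_)
    have hx0 : (0 : ℝ) < x := one_pos.trans hx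
    rw [hn x hx0]
    have h1 : ‖1 - (1 + z * x) ^ (-1 / 2 : ℂ)‖ ≤ 2 := by
      refine (norm_sub_le _ _).trans ?_
      have := norm_cpow_neg_half_le_one hz hx0.le
      rw [norm_one]
      linarith
    gcongr

/-- The function `A` below is an antiderivative: with `s = √(1 + z x)`, the numerator of its
derivative simplifies through `s² = 1 + z x`. It vanishes at `0` and tends to `(2/π) √z` at
infinity. -/
theorem integral_Ioi_intensityDensity_smul {z : ℂ} (hz : z ∈ halfPlane) :
    ∫ x in Set.Ioi (0 : ℝ), intensityDensity x • (1 - (1 + z * x) ^ (-1 / 2 : ℂ))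
      = 2 / Real.pi * z ^ (1 / 2 : ℂ) := by
  set A : ℝ → ℂ := fun x => 2 / Real.pi * (((1 + z * x) ^ (1 / 2 : ℂ) - 1) / (√x : ℝ)) with hA
  have hpi : (Real.pi : ℂ) ≠ 0 := by exact_mod_cast Real.pi_ne_zero
  -- Division by `√0 = 0` gives `0`, which is also the limit of `A` at `0` from the right.
  have hA0 : A 0 = 0 := by simp [hA]
  have hbd : ∀ x, 0 ≤ x → ‖A x‖ ≤ 2 / Real.pi * ‖z‖ * √x := by
    intro x hx
    rcases hx.eq_or_lt with rfl | hx'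
    · simp [hA0]
    have h := norm_cpow_half_sub_one_le hz hx
    have hs : 0 < √x := Real.sqrt_pos.2 hx'
    have h2 : ‖(2 / Real.pi : ℂ)‖ = 2 / Real.pi := by
      rw [norm_div, Complex.norm_of_nonneg Real.pi_pos.le]
      simp
    rw [hA]
    simp only [norm_mul, norm_div] at h2 ⊢
    rw [h2, Complex.norm_of_nonneg hs.le, mul_assoc]
    refine mul_le_mul_of_nonneg_left ?_ (by positivity)
    rw [div_le_iff₀ hs, mul_assoc, Real.mul_self_sqrt hx]
    exact h
  have hcont : ContinuousWithinAt A (Set.Ici 0) 0 := by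
    rw [ContinuousWithinAt, hA0]
    refine squeeze_zero_norm' (a := fun x => 2 / Real.pi * ‖z‖ * √x) ?_ ?_
    · filter_upwards [self_mem_nhdsWithin] with x hx using hbd x hx
    · have : ContinuousAt (fun x => 2 / Real.pi * ‖z‖ * √x) 0 := by fun_prop
      have h := this.tendsto.mono_left (nhdsWithin_le_nhds (s := Set.Ici 0))
      simpa using h
  have hderiv : ∀ x ∈ Set.Ioi (0 : ℝ),
      HasDerivAt A (intensityDensity x • (1 - (1 + z * x) ^ (-1 / 2 : ℂ))) x := by
    intro x hx
    have hx0 : (0 : ℝ) < x := hx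
    have h1 := one_le_re_one_add_mul hz hx0.le
    have hsl : 1 + z * x ∈ Complex.slitPlane := Or.inl (by linarith)
    have hr : 0 < √x := Real.sqrt_pos.2 hx0
    have hr' : ((√x : ℝ) : ℂ) ≠ 0 := by exact_mod_cast hr.ne'
    have hrsq : ((√x : ℝ) : ℂ) ^ 2 = x := by exact_mod_cast Real.sq_sqrt hx0.le
    have hne : (1 + z * x) ^ (1 / 2 : ℂ) ≠ 0 := fun h => by
      have := one_le_norm_cpow_half h1
      rw [h, norm_zero] at this
      linarith
    have hd1 : HasDerivAt (fun x : ℝ => (1 + z * x) ^ (1 / 2 : ℂ))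
        (1 / 2 * ((1 + z * x) ^ (1 / 2 : ℂ))⁻¹ * z) x := by
      have h : HasDerivAt (fun w : ℂ => 1 + z * w) z (x : ℂ) := by
        simpa using ((hasDerivAt_id (x : ℂ)).const_mul z).const_add 1
      have h' := (h.cpow_const (c := 1 / 2) hsl).comp_ofReal
      rwa [show (1 / 2 - 1 : ℂ) = -1 / 2 by norm_num, cpow_neg_half] at h'
    have hd2 : HasDerivAt (fun x : ℝ => ((√x : ℝ) : ℂ)) ((1 / (2 * √x) : ℝ) : ℂ) x :=
      (Real.hasDerivAt_sqrt hx0.ne').ofReal_comp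
    have hd := ((hd1.sub_const 1).div hd2 hr').const_mul (2 / Real.pi : ℂ)
    have hx32 : x ^ (3 / 2 : ℝ) = √x ^ 3 := by
      rw [Real.sqrt_eq_rpow, ← Real.rpow_natCast, ← Real.rpow_mul hx0.le]
      norm_num
    refine hd.congr_deriv ?_
    rw [cpow_neg_half, Complex.real_smul, intensityDensity, hx32]
    have hsq := cpow_half_sq (1 + z * x)
    rw [← hrsq] at hsq hne ⊢
    set s := (1 + z * ((√x : ℝ) : ℂ) ^ 2) ^ (1 / 2 : ℂ)
    push_cast
    field_simp
    linear_combination (-1) * hsq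
  have hlim : Tendsto A atTop (𝓝 (2 / Real.pi * z ^ (1 / 2 : ℂ))) := by
    have hsl : z ∈ Complex.slitPlane := Or.inl hz
    have hinv : Tendsto (fun x : ℝ => ((x⁻¹ : ℝ) : ℂ)) atTop (𝓝 0) := by
      rw [← Complex.ofReal_zero]
      exact (Complex.continuous_ofReal.tendsto 0).comp (tendsto_inv_atTop_zero (𝕜 := ℝ))
    have hinv' : Tendsto (fun x : ℝ => (((√x)⁻¹ : ℝ) : ℂ)) atTop (𝓝 0) := by
      rw [← Complex.ofReal_zero]
      exact (Complex.continuous_ofReal.tendsto 0).comp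
        (tendsto_inv_atTop_zero.comp Real.tendsto_sqrt_atTop)
    have h1 : Tendsto (fun x : ℝ => (z + ((x⁻¹ : ℝ) : ℂ)) ^ (1 / 2 : ℂ)) atTop
        (𝓝 (z ^ (1 / 2 : ℂ))) := by
      have h := hinv.const_add z
      rw [add_zero] at h
      exact (continuousAt_cpow_const hsl).tendsto.comp h
    have h2 := (h1.sub hinv').const_mul (2 / Real.pi : ℂ)
    rw [sub_zero] at h2
    refine h2.congr' ?_
    filter_upwards [eventually_gt_atTop 0] with x hx
    have hr : 0 < √x := Real.sqrt_pos.2 hx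
    have hr' : ((√x : ℝ) : ℂ) ≠ 0 := by exact_mod_cast hr.ne'
    have hx' : (x : ℂ) ≠ 0 := by exact_mod_cast hx.ne'
    -- Both sides have the same square, and positivity of the real part selects the same root.
    have h3 : (1 + z * x) ^ (1 / 2 : ℂ) = (z + ((x⁻¹ : ℝ) : ℂ)) ^ (1 / 2 : ℂ) * (√x : ℝ) := by
      have hrsq : ((√x : ℝ) : ℂ) ^ 2 = x := by exact_mod_cast Real.sq_sqrt hx.le
      have hv : 0 < (z + ((x⁻¹ : ℝ) : ℂ)).re := by
        have hz' : 0 < z.re := hz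
        rw [Complex.add_re, Complex.ofReal_re]
        positivity
      have hre : 0 < ((z + ((x⁻¹ : ℝ) : ℂ)) ^ (1 / 2 : ℂ) * (√x : ℝ)).re := by
        rw [Complex.re_mul_ofReal]
        exact mul_pos (re_cpow_half_pos hv) hr
      rw [← cpow_half_of_sq hre, mul_pow, cpow_half_sq, hrsq]
      push_cast
      congr 1
      field_simp
      ring
    rw [hA]
    simp only
    rw [h3]
    push_cast
    field_simp
  rw [integral_Ioi_of_hasDerivAt_of_tendsto hcont hderiv (integrableOn_intensityDensity_smul hz)
    hlim, hA0, sub_zero]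

/-- The Laplace-type functional of the Poisson process with intensity `1 / (π x ^ (3/2))`. -/
theorem IsPoissonProcess.integral_tprod_cpow_neg_half {Ω : Type*} [MeasurableSpace Ω]
    {P : Measure Ω} [IsProbabilityMeasure P] {ξ : ℕ → Ω → ℝ} (hξ : IsPoissonProcess P intensity ξ)
    {z : ℂ} (hz : z ∈ halfPlane) :
    (∀ᵐ ω ∂P, Multipliable fun i => (1 + z * (ξ i ω : ℂ)) ^ (-1 / 2 : ℂ)) ∧
    Integrable (fun ω => ∏' i, (1 + z * (ξ i ω : ℂ)) ^ (-1 / 2 : ℂ)) P ∧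
    Complex.exp (-(2 / Real.pi) * z ^ (1 / 2 : ℂ))
      = ∫ ω, ∏' i, (1 + z * (ξ i ω : ℂ)) ^ (-1 / 2 : ℂ) ∂P := by
  -- The value `1` off the positive axis makes `‖f‖ ≤ 1` hold everywhere; almost surely no point of
  -- the process lies there.
  set f : ℝ → ℂ := fun x => if 0 < x then (1 + z * x) ^ (-1 / 2 : ℂ) else 1 with hf
  have hfm : Measurable f :=
    (measurable_cpow_neg_half z).ite (measurableSet_lt measurable_const measurable_id)
      measurable_const
  have hf1 : ∀ x, ‖f x‖ ≤ 1 := by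
    intro x
    simp only [hf]
    split_ifs with hx
    · exact norm_cpow_neg_half_le_one hz hx.le
    · simp
  have heq : Set.EqOn (fun x => intensityDensity x • (1 - f x))
      (fun x => intensityDensity x • (1 - (1 + z * x) ^ (-1 / 2 : ℂ))) (Set.Ioi 0) := by
    intro x hx
    simp only [hf, if_pos (show 0 < x from hx)]
  have hfi : Integrable (fun x => 1 - f x) intensity := by
    rw [integrable_intensity_iff, integrableOn_congr_fun heq measurableSet_Ioi]
    exact integrableOn_intensityDensity_smul hz
  have hpos := hξ.ae_forall ae_intensity_pos
  have hae : ∀ᵐ ω ∂P, (fun i => f (ξ i ω)) = fun i => (1 + z * (ξ i ω : ℂ)) ^ (-1 / 2 : ℂ) := by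
    filter_upwards [hpos] with ω hω
    funext i
    simp only [hf, if_pos (hω i)]
  have hae' : (fun ω => ∏' i, f (ξ i ω)) =ᵐ[P]
      fun ω => ∏' i, (1 + z * (ξ i ω : ℂ)) ^ (-1 / 2 : ℂ) := by
    filter_upwards [hae] with ω hω
    rw [hω]
  refine ⟨?_, ?_, ?_⟩
  · filter_upwards [hae, hξ.ae_multipliable hfm hfi] with ω hω h
    rwa [hω] at h
  · refine Integrable.congr ?_ hae'
    exact (integrable_const (1 : ℝ)).mono' (hξ.aestronglyMeasurable_tprod hfm hfi)
      (Eventually.of_forall fun ω => norm_tprod_le_one fun i => hf1 _)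
  · rw [← integral_congr_ae hae', hξ.integral_tprod hfm hf1 hfi, integral_intensity,
      setIntegral_congr_fun measurableSet_Ioi heq, integral_Ioi_intensityDensity_smul hz, neg_mul]

/-! ### The characteristic function of the Cauchy law -/

section Cauchy

open scoped FourierTransform

theorem fourier_exp_neg_abs (w : ℝ) :
    𝓕 (fun x : ℝ => ((Real.exp (-(2 * Real.pi * |x|)) : ℝ) : ℂ)) w
      = (cauchyPDFReal 0 1 w : ℂ) := by
  have hpi := Real.pi_pos
  have hpi' : (Real.pi : ℂ) ≠ 0 := by exact_mod_cast hpi.ne'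
  have e1 : ∀ x ∈ Set.Iic (0 : ℝ), Complex.exp (↑(-2 * Real.pi * x * w) * Complex.I) •
      ((Real.exp (-(2 * Real.pi * |x|)) : ℝ) : ℂ)
        = Complex.exp ((2 * Real.pi * (1 - w * Complex.I)) * x) := by
    intro x hx
    rw [abs_of_nonpos hx, smul_eq_mul, Complex.ofReal_exp, ← Complex.exp_add]
    push_cast
    ring_nf
  have e2 : ∀ x ∈ Set.Ioi (0 : ℝ), Complex.exp (↑(-2 * Real.pi * x * w) * Complex.I) •
      ((Real.exp (-(2 * Real.pi * |x|)) : ℝ) : ℂ)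
        = Complex.exp ((-(2 * Real.pi * (1 + w * Complex.I))) * x) := by
    intro x hx
    rw [abs_of_pos hx, smul_eq_mul, Complex.ofReal_exp, ← Complex.exp_add]
    push_cast
    ring_nf
  have r1 : 0 < (2 * Real.pi * (1 - w * Complex.I)).re := by simp [hpi]
  have r2 : (-(2 * Real.pi * (1 + w * Complex.I))).re < 0 := by simp [hpi]
  have i1 := (integrableOn_exp_mul_complex_Iic r1 0).congr_fun
    (fun x hx => (e1 x hx).symm) measurableSet_Iic
  have i2 := (integrableOn_exp_mul_complex_Ioi r2 0).congr_fun
    (fun x hx => (e2 x hx).symm) measurableSet_Ioi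
  rw [Real.fourier_real_eq_integral_exp_smul, ← intervalIntegral.integral_Iic_add_Ioi i1 i2,
    setIntegral_congr_fun measurableSet_Iic e1, setIntegral_congr_fun measurableSet_Ioi e2,
    integral_exp_mul_complex_Iic r1, integral_exp_mul_complex_Ioi r2, cauchyPDFReal_def]
  have n1 : (1 - w * Complex.I) ≠ 0 := fun h => by simpa using congrArg Complex.re h
  have n2 : (1 + w * Complex.I) ≠ 0 := fun h => by simpa using congrArg Complex.re h
  have n3 : ((w : ℂ) ^ 2 + 1) ≠ 0 := by
    have : (w ^ 2 + 1 : ℝ) ≠ 0 := by positivity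
    exact_mod_cast this
  simp
  field_simp
  linear_combination (2 * (w : ℂ) ^ 2) * Complex.I_sq

/-- The Cauchy density is the Fourier transform of `exp (-2π|x|)`, so Fourier inversion at `t /
(2π)` yields the characteristic function. -/
theorem charFun_cauchyMeasure (t : ℝ) :
    charFun (cauchyMeasure 0 1) t = ((Real.exp (-|t|) : ℝ) : ℂ) := by
  set f : ℝ → ℂ := fun x => ((Real.exp (-(2 * Real.pi * |x|)) : ℝ) : ℂ) with hf
  have hF : 𝓕 f = fun w => (cauchyPDFReal 0 1 w : ℂ) := funext fourier_exp_neg_abs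
  have hcont : Continuous f := by fun_prop
  have hfi : Integrable f := by
    refine Integrable.ofReal ?_
    rw [← integrableOn_univ, ← Set.Iic_union_Ioi (a := (0 : ℝ))]
    refine IntegrableOn.union ?_ ?_
    · refine (integrableOn_exp_mul_Iic (a := 2 * Real.pi) (by simp [Real.pi_pos]) 0).congr_fun
        (fun x hx => ?_) measurableSet_Iic
      simp only [abs_of_nonpos (show x ≤ 0 from hx), mul_neg, neg_neg]
      rfl
    · refine (integrableOn_exp_mul_Ioi (a := -(2 * Real.pi)) (by simp [Real.pi_pos]) 0).congr_fun
        (fun x hx => ?_) measurableSet_Ioi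
      simp only [abs_of_pos (show 0 < x from hx), neg_mul]
      rfl
  have hinv := hcont.fourierInv_fourier_eq hfi (by rw [hF]; exact (integrable_cauchyPDFReal _).ofReal)
  have h := congrFun hinv (t / (2 * Real.pi))
  rw [hF, Real.fourierInv_eq'] at h
  have hpi := Real.pi_pos
  have hpi' : (Real.pi : ℂ) ≠ 0 := by exact_mod_cast hpi.ne'
  rw [charFun_apply_real, cauchyMeasure_of_scale_ne_zero _ one_ne_zero,
    integral_withDensity_eq_integral_toReal_smul (by fun_prop) (by simp [cauchyPDF])]
  have hft : f (t / (2 * Real.pi)) = ((Real.exp (-|t|) : ℝ) : ℂ) := by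
    simp only [hf]
    rw [abs_div, abs_of_pos (show 0 < 2 * Real.pi by positivity), mul_div_cancel₀ _ (by positivity)]
  rw [← hft, ← h]
  congr with x
  have h0 : 0 ≤ cauchyPDFReal 0 1 x := (cauchyPDF_pos 0 one_ne_zero x).le
  rw [cauchyPDF, ENNReal.toReal_ofReal h0, Real.inner_apply, Complex.real_smul, smul_eq_mul,
    mul_comm]
  push_cast
  congr 2
  field_simp

end Cauchy

/-! ### Determinants as Gaussian integrals -/

section Gaussian

theorem integral_exp_neg_sq_gaussianReal {s : ℝ} (hs : 0 ≤ s) :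
    ∫ x, Real.exp (-(s / 2) * x ^ 2) ∂(gaussianReal 0 1) = (1 + s) ^ (-1 / 2 : ℝ) := by
  have hpi := Real.pi_pos
  rw [integral_gaussianReal_eq_integral_smul one_ne_zero]
  have : ∀ x : ℝ, gaussianPDFReal 0 1 x • Real.exp (-(s / 2) * x ^ 2)
      = (√(2 * Real.pi))⁻¹ * Real.exp (-((1 + s) / 2) * x ^ 2) := by
    intro x
    rw [gaussianPDFReal, smul_eq_mul, mul_assoc, ← Real.exp_add]
    simp only [NNReal.coe_one, mul_one, sub_zero]
    ring_nf
  simp_rw [this]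
  rw [integral_const_mul, integral_gaussian, ← Real.sqrt_inv, ← Real.sqrt_mul (by positivity),
    neg_div, Real.rpow_neg (by positivity), ← Real.sqrt_eq_rpow, ← Real.sqrt_inv]
  congr 1
  field_simp

/-- The law of a vector of independent standard Gaussian variables. -/
noncomputable abbrev gaussianPi (ι : Type*) [Fintype ι] : Measure (ι → ℝ) :=
  Measure.pi fun _ : ι => gaussianReal 0 1

/-- Rotation invariance of the standard Gaussian law; it permits integration in the eigenbasis of
`GᵀG`, where the quadratic form is diagonal. -/
theorem integral_gaussianPi_orthonormalBasis {ι : Type*} [Fintype ι]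
    (b : OrthonormalBasis ι ℝ (EuclideanSpace ℝ ι)) {F : (ι → ℝ) → ℝ} (hF : Continuous F) :
    ∫ g, F g ∂(gaussianPi ι) = ∫ x, F (∑ i, x i • (b i).ofLp) ∂(gaussianPi ι) := by
  have hc : Continuous fun v : EuclideanSpace ℝ ι => F v.ofLp := by fun_prop
  have h1 : ∫ v, F (WithLp.ofLp v) ∂(stdGaussian (EuclideanSpace ℝ ι))
      = ∫ g, F g ∂(gaussianPi ι) := by
    rw [← map_pi_eq_stdGaussian, integral_map (by fun_prop) hc.aestronglyMeasurable]
  rw [← h1, stdGaussian_eq_map_pi_orthonormalBasis b,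
    integral_map (Continuous.aemeasurable (by fun_prop)) hc.aestronglyMeasurable]
  congr with x
  congr 1
  simp

theorem sum_mulVec_sq_eq {m n : ℕ} (G : Matrix (Fin m) (Fin n) ℝ) (x : Fin n → ℝ) :
    ∑ j, (G *ᵥ (∑ i, x i • ((isHermitian_gram G).eigenvectorBasis i).ofLp)) j ^ 2
      = ∑ i, gramEigenvalues G i * x i ^ 2 := by
  set b := (isHermitian_gram G).eigenvectorBasis
  set v : Fin n → ℝ := ∑ i, x i • (b i).ofLp with hv
  have h1 : ∑ j, (G *ᵥ v) j ^ 2 = v ⬝ᵥ ((Gᵀ * G) *ᵥ v) := by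
    rw [← Matrix.mulVec_mulVec, Matrix.dotProduct_mulVec, Matrix.vecMul_transpose]
    simp [dotProduct, sq]
  have h2 : (Gᵀ * G) *ᵥ v = ∑ i, (gramEigenvalues G i * x i) • (b i).ofLp := by
    rw [hv, Matrix.mulVec_sum]
    refine Finset.sum_congr rfl fun i _ => ?_
    rw [Matrix.mulVec_smul, (isHermitian_gram G).mulVec_eigenvectorBasis i, smul_smul, mul_comm]
    rfl
  have horth : ∀ i k, (b i).ofLp ⬝ᵥ (b k).ofLp = if i = k then 1 else 0 := by
    intro i k
    have := orthonormal_iff_ite.1 b.orthonormal k i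
    rw [EuclideanSpace.inner_eq_star_dotProduct] at this
    simpa [eq_comm] using this
  rw [h1, h2, hv, sum_dotProduct]
  refine Finset.sum_congr rfl fun i _ => ?_
  rw [dotProduct_sum, Finset.sum_eq_single i]
  · simp [horth]
    ring
  · intro k _ hk
    simp [horth, hk.symm]
  · simp

theorem gramEigenvalues_nonneg {m n : ℕ} (G : Matrix (Fin m) (Fin n) ℝ) (i : Fin n) :
    0 ≤ gramEigenvalues G i :=
  (posSemidef_gram G).eigenvalues_nonneg i

theorem det_one_add_smul_gram {m n : ℕ} (G : Matrix (Fin m) (Fin n) ℝ) (t : ℝ) :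
    (1 + t • (Gᵀ * G)).det = ∏ i, (1 + t * gramEigenvalues G i) := by
  have h := det_one_add_smul (isHermitian_gram G) (t : ℂ)
  have hm : (1 + (t : ℂ) • (Gᵀ * G).map (fun x : ℝ => (x : ℂ)))
      = (1 + t • (Gᵀ * G)).map Complex.ofRealHom := by
    ext i j
    by_cases hij : i = j
    · subst hij
      simp
    · simp [hij]
  rw [hm, ← RingHom.mapMatrix_apply, ← RingHom.map_det, Complex.ofRealHom_eq_coe] at h
  apply Complex.ofReal_injective
  rw [h]
  push_cast
  rfl

theorem det_one_add_smul_gram_rpow {m n : ℕ} (G : Matrix (Fin m) (Fin n) ℝ) {t : ℝ} (ht : 0 ≤ t) :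
    (1 + t • (Gᵀ * G)).det ^ (-1 / 2 : ℝ) = ∏ i, (1 + t * gramEigenvalues G i) ^ (-1 / 2 : ℝ) := by
  rw [det_one_add_smul_gram, Real.finsetProd_rpow _ _ fun i _ => ?_]
  have := mul_nonneg ht (gramEigenvalues_nonneg G i)
  linarith

/-- The Gaussian integral representation of `det (1 + t GᵀG) ^ (-1/2)`. -/
theorem integral_exp_neg_sum_mulVec_sq {m n : ℕ} (G : Matrix (Fin m) (Fin n) ℝ) {t : ℝ}
    (ht : 0 ≤ t) :
    ∫ g, Real.exp (-(t / 2) * ∑ j, (G *ᵥ g) j ^ 2) ∂(gaussianPi (Fin n))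
      = (1 + t • (Gᵀ * G)).det ^ (-1 / 2 : ℝ) := by
  rw [integral_gaussianPi_orthonormalBasis (isHermitian_gram G).eigenvectorBasis
    (by simp only [Matrix.mulVec, dotProduct]; fun_prop), det_one_add_smul_gram_rpow G ht]
  simp_rw [sum_mulVec_sq_eq, Finset.mul_sum, Real.exp_sum]
  rw [integral_fintype_prod_eq_prod
    (fun i (x : ℝ) => Real.exp (-(t / 2) * (gramEigenvalues G i * x ^ 2)))]
  refine Finset.prod_congr rfl fun i _ => ?_
  rw [← integral_exp_neg_sq_gaussianReal (mul_nonneg ht (gramEigenvalues_nonneg G i))]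
  congr with x
  ring_nf

end Gaussian

/-! ### Extension from positive reals to the half-plane -/

section Holomorphic

theorem isOpen_halfPlane : IsOpen halfPlane :=
  isOpen_lt continuous_const Complex.continuous_re

/-- Holomorphic functions on the right half-plane that agree on the positive reals are equal. -/
theorem eqOn_halfPlane_of_eq_ofReal {f g : ℂ → ℂ} (hf : DifferentiableOn ℂ f halfPlane)
    (hg : DifferentiableOn ℂ g halfPlane) (h : ∀ t : ℝ, 0 < t → f t = g t) :
    Set.EqOn f g halfPlane := by
  have hc : IsPreconnected halfPlane := (convex_halfSpace_re_gt 0).isPreconnected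
  have h1 : (1 : ℂ) ∈ halfPlane := by simp [halfPlane]
  refine (hf.analyticOnNhd isOpen_halfPlane).eqOn_of_preconnected_of_frequently_eq
    (hg.analyticOnNhd isOpen_halfPlane) hc h1 ?_
  have ht : Tendsto (fun k : ℕ => (((1 : ℝ) + 1 / ((k : ℝ) + 1) : ℝ) : ℂ)) atTop (𝓝[≠] 1) := by
    refine tendsto_nhdsWithin_iff.2 ⟨?_, Eventually.of_forall fun k => ?_⟩
    · have := (tendsto_one_div_add_atTop_nhds_zero_nat (𝕜 := ℝ)).const_add 1
      rw [add_zero] at this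
      exact (Complex.continuous_ofReal.tendsto _).comp this
    · have : (0 : ℝ) < 1 / ((k : ℝ) + 1) := by positivity
      intro h
      have h' := congrArg Complex.re (Set.mem_singleton_iff.1 h)
      rw [Complex.ofReal_re, Complex.one_re] at h'
      linarith
  exact ht.frequently (Eventually.frequently (Eventually.of_forall fun k => h _ (by positivity)))

/-- The Laplace transform of a nonnegative random variable is holomorphic on the half-plane. -/
theorem differentiableOn_integral_exp_neg_mul {α : Type*} [MeasurableSpace α] {μ : Measure α}
    [IsFiniteMeasure μ] {Y : α → ℝ} (hY : AEMeasurable Y μ) (hY0 : ∀ x, 0 ≤ Y x) :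
    DifferentiableOn ℂ (fun z : ℂ => ∫ x, Complex.exp (-z * Y x) ∂μ) halfPlane := by
  -- The integral is the complex moment generating function of `Y` at `-z`, holomorphic over the
  -- interior of the set of integrable exponents. As `Y ≥ 0`, that set contains the negative axis.
  have hsub : Set.Iio (0 : ℝ) ⊆ interior (integrableExpSet Y μ) := by
    refine interior_maximal (fun t ht => ?_) isOpen_Iio
    have ht' : t < 0 := ht
    refine (integrable_const (1 : ℝ)).mono' (by fun_prop) (Eventually.of_forall fun x => ?_)
    rw [Real.norm_of_nonneg (Real.exp_nonneg _), Real.exp_le_one_iff]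
    exact mul_nonpos_of_nonpos_of_nonneg ht'.le (hY0 x)
  have h := differentiableOn_complexMGF (X := Y) (μ := μ)
  refine (h.comp (t := _) (f := fun z : ℂ => -z) (by fun_prop) fun z hz => ?_)
  exact hsub (by simpa using (show 0 < z.re from hz))

/-- Each factor `1 + z x` stays in the right half-plane, so the product of principal powers is
holomorphic and agrees with the branch on positive reals. -/
theorem invSqrtDet_eq_prod {m n : ℕ} (G : Matrix (Fin m) (Fin n) ℝ) {c : ℝ} (hc : 0 ≤ c) {z : ℂ}
    (hz : z ∈ halfPlane) :
    invSqrtDet ((1 / c) • (Gᵀ * G)) z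
      = ∏ i, (1 + z * ((gramEigenvalues G i / c : ℝ) : ℂ)) ^ (-1 / 2 : ℂ) := by
  have hM := isInvSqrtDet_invSqrtDet ((posSemidef_gram G).smul (one_div_nonneg.2 hc))
  refine eqOn_halfPlane_of_eq_ofReal (g := fun z =>
    ∏ i, (1 + z * ((gramEigenvalues G i / c : ℝ) : ℂ)) ^ (-1 / 2 : ℂ))
    hM.differentiableOn ?_ (fun t ht => ?_) hz
  · refine DifferentiableOn.fun_finsetProd fun i _ => ?_
    refine DifferentiableOn.cpow (by fun_prop) (by fun_prop) fun z hz => Or.inl ?_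
    linarith [one_le_re_one_add_mul hz (div_nonneg (gramEigenvalues_nonneg G i) hc)]
  · rw [hM.ofReal t ht, smul_smul, det_one_add_smul_gram_rpow G (by positivity)]
    push_cast
    refine Finset.prod_congr rfl fun i _ => ?_
    have h0 : 0 ≤ 1 + t * (1 / c) * gramEigenvalues G i := by
      have := gramEigenvalues_nonneg G i
      positivity
    rw [Complex.ofReal_cpow h0]
    push_cast
    congr 1
    ring

theorem invSqrtDet_eq_integral {m n : ℕ} (G : Matrix (Fin m) (Fin n) ℝ) {c : ℝ} (hc : 0 ≤ c)
    {z : ℂ} (hz : z ∈ halfPlane) :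
    invSqrtDet ((1 / c) • (Gᵀ * G)) z
      = ∫ g, Complex.exp (-z * ((∑ j, (G *ᵥ g) j ^ 2) / (2 * c) : ℝ)) ∂(gaussianPi (Fin n)) := by
  have hM := isInvSqrtDet_invSqrtDet ((posSemidef_gram G).smul (one_div_nonneg.2 hc))
  refine eqOn_halfPlane_of_eq_ofReal hM.differentiableOn
    (differentiableOn_integral_exp_neg_mul ?_ fun g => by positivity) (fun t ht => ?_) hz
  · have : Continuous fun g : Fin n → ℝ => (∑ j, (G *ᵥ g) j ^ 2) / (2 * c) := by
      simp only [Matrix.mulVec, dotProduct]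
      fun_prop
    exact this.aemeasurable
  · rw [hM.ofReal t ht, smul_smul, ← integral_exp_neg_sum_mulVec_sq G (by positivity),
      ← integral_complex_ofReal]
    congr with g
    push_cast
    congr 1
    ring

end Holomorphic

/-! ### Averaging over the Cauchy entries -/

theorem integral_pi_exp_sum_mul_I {ι : Type*} [Fintype ι] (ν : Measure ℝ) [SigmaFinite ν]
    (c : ι → ℝ) :
    ∫ y, Complex.exp (((∑ i, c i * y i : ℝ) : ℂ) * Complex.I) ∂(Measure.pi fun _ : ι => ν)
      = ∏ i, charFun ν (c i) := by
  simp_rw [charFun_apply_real]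
  rw [← integral_fintype_prod_eq_prod (fun i (x : ℝ) => Complex.exp (c i * x * Complex.I))]
  congr with y
  rw [← Complex.exp_sum, ← Finset.sum_mul]
  push_cast
  rfl

theorem integral_gaussianPi_exp_sum_mul_I {ι : Type*} [Fintype ι] (c : ι → ℝ) :
    ∫ y, Complex.exp (((∑ i, c i * y i : ℝ) : ℂ) * Complex.I) ∂(gaussianPi ι)
      = ((Real.exp (-(1 / 2) * ∑ i, c i ^ 2) : ℝ) : ℂ) := by
  rw [integral_pi_exp_sum_mul_I]
  simp_rw [charFun_gaussianReal]
  rw [← Complex.exp_sum, Complex.ofReal_exp]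
  congr 1
  push_cast
  rw [Finset.mul_sum]
  refine Finset.sum_congr rfl fun i _ => ?_
  simp
  ring

theorem integral_cauchyPi_exp_sum_mul_I {ι : Type*} [Fintype ι] (c : ι → ℝ) :
    ∫ y, Complex.exp (((∑ i, c i * y i : ℝ) : ℂ) * Complex.I)
        ∂(Measure.pi fun _ : ι => cauchyMeasure 0 1)
      = ((Real.exp (-∑ i, |c i|) : ℝ) : ℂ) := by
  rw [integral_pi_exp_sum_mul_I]
  simp_rw [charFun_cauchyMeasure]
  rw [← Complex.ofReal_prod, ← Real.exp_sum, Finset.sum_neg_distrib]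

theorem norm_exp_ofReal_mul_I_le (x : ℝ) : ‖Complex.exp ((x : ℂ) * Complex.I)‖ ≤ 1 :=
  (Complex.norm_exp_ofReal_mul_I x).le

variable {m n : ℕ}

/-- The matrix `Γ` as a function of the array of its random entries. -/
abbrev sparseArray (Q : Matrix (Fin m) (Fin n) ℝ) (y : Fin m × Fin n → ℝ) :
    Matrix (Fin m) (Fin n) ℝ :=
  sparse Q (fun j k (y : Fin m × Fin n → ℝ) => y (j, k)) y

theorem continuous_sum_sparseArray_mulVec_sq (Q : Matrix (Fin m) (Fin n) ℝ) :
    Continuous fun p : (Fin m × Fin n → ℝ) × (Fin n → ℝ) =>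
      ∑ j, (sparseArray Q p.1 *ᵥ p.2) j ^ 2 := by
  simp only [Matrix.mulVec, dotProduct, sparseArray, sparse, Matrix.of_apply]
  fun_prop

/-- The bilinear form `∑ q_jk |h_j| |g_k|`. -/
noncomputable def absForm (Q : Matrix (Fin m) (Fin n) ℝ) (p : (Fin m → ℝ) × (Fin n → ℝ)) : ℝ :=
  ∑ j, ∑ k, Q j k * (|p.1 j| * |p.2 k|)

theorem continuous_absForm (Q : Matrix (Fin m) (Fin n) ℝ) : Continuous (absForm Q) := by
  unfold absForm
  fun_prop

theorem absForm_nonneg {Q : Matrix (Fin m) (Fin n) ℝ} (hQ : ∀ j k, 0 ≤ Q j k)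
    (p : (Fin m → ℝ) × (Fin n → ℝ)) : 0 ≤ absForm Q p :=
  Finset.sum_nonneg fun j _ => Finset.sum_nonneg fun k _ => by
    have := hQ j k
    positivity

/-- The law of an array of independent standard Cauchy variables. -/
noncomputable abbrev cauchyPi (m n : ℕ) : Measure (Fin m × Fin n → ℝ) :=
  Measure.pi fun _ => cauchyMeasure 0 1

/-- Averaging the determinant over the Cauchy entries leaves a Gaussian average. -/
theorem integral_cauchyPi_det_rpow {Q : Matrix (Fin m) (Fin n) ℝ} (hQ : ∀ j k, 0 ≤ Q j k) {s : ℝ}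
    (hs : 0 ≤ s) :
    ∫ y, (1 + s ^ 2 • ((sparseArray Q y)ᵀ * sparseArray Q y)).det ^ (-1 / 2 : ℝ) ∂(cauchyPi m n)
      = ∫ p, Real.exp (-s * absForm Q p) ∂((gaussianPi (Fin m)).prod (gaussianPi (Fin n))) := by
  have hcont : Continuous fun r : (Fin m × Fin n → ℝ) × ((Fin m → ℝ) × (Fin n → ℝ)) =>
      Complex.exp (((∑ j, s * (sparseArray Q r.1 *ᵥ r.2.2) j * r.2.1 j : ℝ) : ℂ)
        * Complex.I) := by
    simp only [Matrix.mulVec, dotProduct, sparseArray, sparse, Matrix.of_apply]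
    fun_prop
  -- The second Gaussian vector `p.1` linearizes the square: integrating it out returns `exp
  -- (-s²|Γg|²/2)`.
  have h1 : ∀ y, (((1 + s ^ 2 • ((sparseArray Q y)ᵀ * sparseArray Q y)).det ^ (-1 / 2 : ℝ) : ℝ) : ℂ)
      = ∫ p, Complex.exp (((∑ j, s * (sparseArray Q y *ᵥ p.2) j * p.1 j : ℝ) : ℂ) * Complex.I)
          ∂((gaussianPi (Fin m)).prod (gaussianPi (Fin n))) := by
    intro y
    have hi : Integrable (fun p : (Fin m → ℝ) × (Fin n → ℝ) =>
        Complex.exp (((∑ j, s * (sparseArray Q y *ᵥ p.2) j * p.1 j : ℝ) : ℂ) * Complex.I))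
        ((gaussianPi (Fin m)).prod (gaussianPi (Fin n))) :=
      (integrable_const (1 : ℝ)).mono'
        (hcont.comp (Continuous.prodMk_right y)).aestronglyMeasurable
        (Eventually.of_forall fun p => norm_exp_ofReal_mul_I_le _)
    rw [integral_prod_symm _ hi, ← integral_exp_neg_sum_mulVec_sq _ (sq_nonneg s),
      ← integral_complex_ofReal]
    congr with g
    rw [integral_gaussianPi_exp_sum_mul_I (fun j => s * (sparseArray Q y *ᵥ g) j)]
    simp_rw [mul_pow]
    rw [← Finset.mul_sum]
    ring_nf
  -- For fixed Gaussian vectors the phase is linear in the independent Cauchy entries, so each entry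
  -- contributes its characteristic function.
  have h2 : ∀ p : (Fin m → ℝ) × (Fin n → ℝ), ∫ y, Complex.exp (((∑ j, s *
      (sparseArray Q y *ᵥ p.2) j * p.1 j : ℝ) : ℂ) * Complex.I) ∂(cauchyPi m n)
        = ((Real.exp (-s * absForm Q p) : ℝ) : ℂ) := by
    intro p
    have e1 : ∀ y : Fin m × Fin n → ℝ, ∑ j, s * (sparseArray Q y *ᵥ p.2) j * p.1 j
        = ∑ r : Fin m × Fin n, (s * (Q r.1 r.2 * (p.1 r.1 * p.2 r.2))) * y r := by
      intro y
      rw [Fintype.sum_prod_type]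
      refine Finset.sum_congr rfl fun j _ => ?_
      rw [Matrix.mulVec, dotProduct, Finset.mul_sum, Finset.sum_mul]
      refine Finset.sum_congr rfl fun k _ => ?_
      simp only [sparseArray, sparse, Matrix.of_apply]
      ring
    simp_rw [e1]
    rw [integral_cauchyPi_exp_sum_mul_I
      (fun r : Fin m × Fin n => s * (Q r.1 r.2 * (p.1 r.1 * p.2 r.2)))]
    congr 2
    rw [absForm, neg_mul, Fintype.sum_prod_type, Finset.mul_sum]
    congr 1
    refine Finset.sum_congr rfl fun j _ => ?_
    rw [Finset.mul_sum]
    refine Finset.sum_congr rfl fun k _ => ?_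
    rw [abs_mul, abs_mul, abs_mul, abs_of_nonneg hs, abs_of_nonneg (hQ j k)]
  have hI : Integrable (Function.uncurry fun (y : Fin m × Fin n → ℝ)
      (p : (Fin m → ℝ) × (Fin n → ℝ)) => Complex.exp (((∑ j, s * (sparseArray Q y *ᵥ p.2) j
        * p.1 j : ℝ) : ℂ) * Complex.I))
      ((cauchyPi m n).prod ((gaussianPi (Fin m)).prod (gaussianPi (Fin n)))) :=
    (integrable_const (1 : ℝ)).mono' hcont.aestronglyMeasurable
      (Eventually.of_forall fun p => norm_exp_ofReal_mul_I_le _)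
  apply Complex.ofReal_injective
  rw [← integral_complex_ofReal, ← integral_complex_ofReal]
  simp_rw [h1]
  rw [integral_integral_swap hI]
  simp_rw [h2]

theorem norm_exp_neg_mul_le_one {z : ℂ} (hz : z ∈ halfPlane) {x : ℝ} (hx : 0 ≤ x) :
    ‖Complex.exp (-z * x)‖ ≤ 1 := by
  have hz' : 0 < z.re := hz
  rw [Complex.norm_exp, Complex.re_mul_ofReal, Complex.neg_re, Real.exp_le_one_iff]
  nlinarith

theorem stronglyMeasurable_invSqrtDet_sparseArray (Q : Matrix (Fin m) (Fin n) ℝ) {c : ℝ}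
    (hc : 0 ≤ c) {z : ℂ} (hz : z ∈ halfPlane) :
    StronglyMeasurable fun y => invSqrtDet ((1 / c) • ((sparseArray Q y)ᵀ * sparseArray Q y)) z := by
  simp_rw [fun y => invSqrtDet_eq_integral (sparseArray Q y) hc hz]
  have hcont : Continuous fun p : (Fin m × Fin n → ℝ) × (Fin n → ℝ) =>
      Complex.exp (-z * ((∑ j, (sparseArray Q p.1 *ᵥ p.2) j ^ 2) / (2 * c) : ℝ)) := by
    have := continuous_sum_sparseArray_mulVec_sq Q
    fun_prop
  exact hcont.stronglyMeasurable.integral_prod_right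

theorem norm_invSqrtDet_le_one (G : Matrix (Fin m) (Fin n) ℝ) {c : ℝ} (hc : 0 ≤ c) {z : ℂ}
    (hz : z ∈ halfPlane) : ‖invSqrtDet ((1 / c) • (Gᵀ * G)) z‖ ≤ 1 := by
  rw [invSqrtDet_eq_prod G hc hz, norm_prod]
  exact Finset.prod_le_one (fun i _ => norm_nonneg _) fun i _ =>
    norm_cpow_neg_half_le_one hz (div_nonneg (gramEigenvalues_nonneg G i) hc)

/-- The Gaussian average representing the expected inverse square root of the determinant. -/
theorem integral_cauchyPi_invSqrtDet {Q : Matrix (Fin m) (Fin n) ℝ} (hQ : ∀ j k, 0 ≤ Q j k) {d : ℝ}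
    (hd : 0 ≤ d) {z : ℂ} (hz : z ∈ halfPlane) :
    ∫ y, invSqrtDet ((1 / d ^ 2) • ((sparseArray Q y)ᵀ * sparseArray Q y)) z ∂(cauchyPi m n)
      = ∫ p, Complex.exp (-z ^ (1 / 2 : ℂ) * ((absForm Q p / d : ℝ) : ℂ))
          ∂((gaussianPi (Fin m)).prod (gaussianPi (Fin n))) := by
  have hc : 0 ≤ d ^ 2 := sq_nonneg d
  set Y : (Fin m × Fin n → ℝ) × (Fin n → ℝ) → ℝ := fun p =>
    (∑ j, (sparseArray Q p.1 *ᵥ p.2) j ^ 2) / (2 * d ^ 2) with hY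
  have hYc : Continuous Y := (continuous_sum_sparseArray_mulVec_sq Q).div_const _
  have hY0 : ∀ p, 0 ≤ Y p := fun p => by simp only [hY]; positivity
  have hL : ∀ z ∈ halfPlane,
      ∫ y, invSqrtDet ((1 / d ^ 2) • ((sparseArray Q y)ᵀ * sparseArray Q y)) z ∂(cauchyPi m n)
        = ∫ p, Complex.exp (-z * Y p) ∂((cauchyPi m n).prod (gaussianPi (Fin n))) := by
    intro z hz
    rw [integral_prod]
    · simp_rw [fun y => invSqrtDet_eq_integral (sparseArray Q y) hc hz]
      rfl
    · exact (integrable_const (1 : ℝ)).mono' (by fun_prop : Continuous fun p =>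
        Complex.exp (-z * Y p)).aestronglyMeasurable
        (Eventually.of_forall fun p => norm_exp_neg_mul_le_one hz (hY0 p))
  rw [hL z hz]
  -- Since `√z` again has positive real part, the right side is a Laplace transform composed with a
  -- holomorphic map.
  refine eqOn_halfPlane_of_eq_ofReal (g := fun z => ∫ p, Complex.exp (-z ^ (1 / 2 : ℂ) *
      ((absForm Q p / d : ℝ) : ℂ)) ∂((gaussianPi (Fin m)).prod (gaussianPi (Fin n))))
    (differentiableOn_integral_exp_neg_mul hYc.aemeasurable hY0) ?_ (fun t ht => ?_) hz
  · have hX := (continuous_absForm Q).div_const d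
    refine (differentiableOn_integral_exp_neg_mul (μ := (gaussianPi (Fin m)).prod
      (gaussianPi (Fin n))) hX.aemeasurable fun p => div_nonneg (absForm_nonneg hQ p) hd).comp
      (f := fun z : ℂ => z ^ (1 / 2 : ℂ)) ?_ fun z hz => re_cpow_half_pos hz
    exact DifferentiableOn.cpow_const differentiableOn_id fun z hz => Or.inl hz
  · have ht' : (t : ℂ) ∈ halfPlane := by simpa [halfPlane] using ht
    have hst : (t : ℂ) ^ (1 / 2 : ℂ) = (√t : ℝ) := by
      rw [Real.sqrt_eq_rpow, Complex.ofReal_cpow ht.le]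
      norm_num
    have hs2 : (√t / d) ^ 2 = t * (1 / d ^ 2) := by
      rw [div_pow, Real.sq_sqrt ht.le]
      ring
    have key := integral_cauchyPi_det_rpow hQ (s := √t / d) (by positivity)
    rw [← hL t ht']
    have e1 : ∀ y, invSqrtDet ((1 / d ^ 2) • ((sparseArray Q y)ᵀ * sparseArray Q y)) t
        = (((1 + (√t / d) ^ 2 • ((sparseArray Q y)ᵀ * sparseArray Q y)).det
          ^ (-1 / 2 : ℝ) : ℝ) : ℂ) := by
      intro y
      rw [(isInvSqrtDet_invSqrtDet ((posSemidef_gram (sparseArray Q y)).smul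
        (one_div_nonneg.2 hc))).ofReal t ht, smul_smul, hs2]
    simp_rw [e1]
    rw [integral_complex_ofReal, key, ← integral_complex_ofReal]
    congr with p
    rw [hst]
    push_cast
    congr 1
    ring

/-! ### Mean and variance of the absolute bilinear form -/

section Moments

theorem integral_abs_gaussianReal : ∫ x, |x| ∂(gaussianReal 0 1) = √(2 / Real.pi) := by
  have hpi := Real.pi_pos
  rw [integral_gaussianReal_eq_integral_smul one_ne_zero]
  have h1 : ∀ x : ℝ, gaussianPDFReal 0 1 x • |x|
      = (fun y => (√(2 * Real.pi))⁻¹ * (y ^ (1 : ℝ) * Real.exp (-(1 / 2) * y ^ (2 : ℝ)))) |x| := by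
    intro x
    simp only [gaussianPDFReal, smul_eq_mul, Real.rpow_one, Real.rpow_two, sq_abs, NNReal.coe_one,
      mul_one, sub_zero]
    rw [show -x ^ 2 / 2 = -(1 / 2) * x ^ 2 by ring]
    ring
  rw [integral_congr_ae (Eventually.of_forall h1), integral_comp_abs (f := fun y : ℝ =>
    (√(2 * Real.pi))⁻¹ * (y ^ (1 : ℝ) * Real.exp (-(1 / 2) * y ^ (2 : ℝ)))), integral_const_mul,
    integral_rpow_mul_exp_neg_mul_rpow two_pos (by norm_num) (by norm_num)]
  norm_num
  have h2 : √2 * √2 = 2 := Real.mul_self_sqrt two_pos.le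
  have h3 : 0 < √Real.pi := Real.sqrt_pos.2 hpi
  have h4 : 0 < √(2 : ℝ) := by positivity
  field_simp
  linarith

theorem integral_abs_mul_abs_gaussianReal : ∫ x, |x| * |x| ∂(gaussianReal 0 1) = 1 := by
  have h := variance_fun_id_gaussianReal (μ := 0) (v := 1)
  rw [variance_eq_integral (by fun_prop)] at h
  simp only [integral_id_gaussianReal, sub_zero, NNReal.coe_one] at h
  simpa [abs_mul_abs_self, sq] using h

variable {ι : Type*} [Fintype ι]

theorem memLp_abs_eval (i : ι) : MemLp (fun h : ι → ℝ => |h i|) 2 (gaussianPi ι) :=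
  ((memLp_id_gaussianReal' 2 (by simp)).comp_measurePreserving
    (measurePreserving_eval (fun _ : ι => gaussianReal 0 1) i)).abs

theorem integrable_abs_eval (i : ι) : Integrable (fun h : ι → ℝ => |h i|) (gaussianPi ι) :=
  (memLp_abs_eval i).integrable one_le_two

theorem integrable_abs_mul_abs_eval (i j : ι) :
    Integrable (fun h : ι → ℝ => |h i| * |h j|) (gaussianPi ι) :=
  (memLp_abs_eval i).integrable_mul (memLp_abs_eval j)

theorem integral_abs_eval (i : ι) : ∫ h, |h i| ∂(gaussianPi ι) = √(2 / Real.pi) := by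
  rw [← integral_abs_gaussianReal]
  exact integral_comp_eval (μ := fun _ : ι => gaussianReal 0 1) (f := fun x : ℝ => |x|)
    continuous_abs.aestronglyMeasurable

theorem integral_abs_mul_abs_eval [DecidableEq ι] (i j : ι) :
    ∫ h, |h i| * |h j| ∂(gaussianPi ι) = if i = j then 1 else 2 / Real.pi := by
  split_ifs with hij
  · subst hij
    rw [← integral_abs_mul_abs_gaussianReal]
    exact integral_comp_eval (μ := fun _ : ι => gaussianReal 0 1) (f := fun x : ℝ => |x| * |x|)
      (continuous_abs.mul continuous_abs).aestronglyMeasurable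
  · have hind : iIndepFun (fun (i : ι) (h : ι → ℝ) => |h i|) (gaussianPi ι) :=
      iIndepFun_pi (X := fun _ x => |x|) fun i => by fun_prop
    rw [(hind.indepFun hij).integral_fun_mul_eq_mul_integral
      (integrable_abs_eval i).1 (integrable_abs_eval j).1,
      integral_abs_eval, integral_abs_eval, Real.mul_self_sqrt (by positivity)]

variable {m n : ℕ}

theorem absForm_eq_sum (Q : Matrix (Fin m) (Fin n) ℝ) (p : (Fin m → ℝ) × (Fin n → ℝ)) :
    absForm Q p = ∑ r : Fin m × Fin n, Q r.1 r.2 * (|p.1 r.1| * |p.2 r.2|) := by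
  rw [absForm, Fintype.sum_prod_type]

theorem absForm_sq_eq_sum (Q : Matrix (Fin m) (Fin n) ℝ) (p : (Fin m → ℝ) × (Fin n → ℝ)) :
    absForm Q p ^ 2 = ∑ r : Fin m × Fin n, ∑ r' : Fin m × Fin n, Q r.1 r.2 * Q r'.1 r'.2 *
      ((|p.1 r.1| * |p.1 r'.1|) * (|p.2 r.2| * |p.2 r'.2|)) := by
  rw [sq, absForm_eq_sum, Finset.sum_mul_sum]
  refine Finset.sum_congr rfl fun r _ => Finset.sum_congr rfl fun r' _ => ?_
  ring

theorem integrable_absForm (Q : Matrix (Fin m) (Fin n) ℝ) :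
    Integrable (absForm Q) ((gaussianPi (Fin m)).prod (gaussianPi (Fin n))) := by
  rw [show absForm Q = _ from funext (absForm_eq_sum Q)]
  exact integrable_finsetSum _ fun r _ =>
    ((integrable_abs_eval r.1).mul_prod (integrable_abs_eval r.2)).const_mul _

theorem integrable_absForm_sq (Q : Matrix (Fin m) (Fin n) ℝ) :
    Integrable (fun p => absForm Q p ^ 2) ((gaussianPi (Fin m)).prod (gaussianPi (Fin n))) := by
  simp_rw [absForm_sq_eq_sum]
  exact integrable_finsetSum _ fun r _ => integrable_finsetSum _ fun r' _ =>
    ((integrable_abs_mul_abs_eval r.1 r'.1).mul_prod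
      (integrable_abs_mul_abs_eval r.2 r'.2)).const_mul _

theorem integral_absForm (Q : Matrix (Fin m) (Fin n) ℝ) :
    ∫ p, absForm Q p ∂((gaussianPi (Fin m)).prod (gaussianPi (Fin n)))
      = 2 / Real.pi * ∑ j, ∑ k, Q j k := by
  have hpi := Real.pi_pos
  simp_rw [absForm_eq_sum]
  rw [integral_finsetSum _ fun r _ =>
    ((integrable_abs_eval r.1).mul_prod (integrable_abs_eval r.2)).const_mul _,
    ← Fintype.sum_prod_type' (f := fun j k => Q j k), Finset.mul_sum]
  refine Finset.sum_congr rfl fun r _ => ?_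
  rw [integral_const_mul, integral_prod_mul (fun h : Fin m → ℝ => |h r.1|)
    (fun g : Fin n → ℝ => |g r.2|), integral_abs_eval, integral_abs_eval,
    Real.mul_self_sqrt (by positivity), mul_comm]

/-- A pair of positions sharing neither row nor column contributes exactly the product of its means,
`(2/π)²`. Sharing a row or a column replaces a factor `2/π` by `1`, an excess of at most `1` for
each coincidence. -/
theorem integral_absForm_sq_le {Q : Matrix (Fin m) (Fin n) ℝ} (hQ0 : ∀ j k, 0 ≤ Q j k) :
    ∫ p, absForm Q p ^ 2 ∂((gaussianPi (Fin m)).prod (gaussianPi (Fin n)))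
      ≤ (2 / Real.pi * ∑ j, ∑ k, Q j k) ^ 2
        + (∑ j, (∑ k, Q j k) ^ 2 + ∑ k, (∑ j, Q j k) ^ 2) := by
  have hpi := Real.pi_gt_three
  have hp1 : 2 / Real.pi ≤ 1 := by rw [div_le_one (by positivity)]; linarith
  have hp0 : 0 ≤ 2 / Real.pi := by positivity
  simp_rw [absForm_sq_eq_sum]
  have hi := fun r r' : Fin m × Fin n => ((integrable_abs_mul_abs_eval r.1 r'.1).mul_prod
      (integrable_abs_mul_abs_eval r.2 r'.2)).const_mul (Q r.1 r.2 * Q r'.1 r'.2)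
  rw [integral_finsetSum _ fun r _ => integrable_finsetSum _ fun r' _ => hi r r']
  simp_rw [fun r => integral_finsetSum Finset.univ fun r' _ => hi r r', integral_const_mul,
    fun r r' : Fin m × Fin n => integral_prod_mul (μ := gaussianPi (Fin m))
      (ν := gaussianPi (Fin n)) (fun h : Fin m → ℝ => |h r.1| * |h r'.1|)
      (fun g : Fin n → ℝ => |g r.2| * |g r'.2|), integral_abs_mul_abs_eval]
  have hM : ∑ j, ∑ k, Q j k = ∑ r : Fin m × Fin n, Q r.1 r.2 := by
    rw [← Fintype.sum_prod_type' (f := fun j k => Q j k)]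
  have hrow : ∑ j, (∑ k, Q j k) ^ 2 = ∑ r : Fin m × Fin n, ∑ r' : Fin m × Fin n,
      Q r.1 r.2 * Q r'.1 r'.2 * (if r.1 = r'.1 then 1 else 0) := by
    simp_rw [Fintype.sum_prod_type, sq, Finset.sum_mul_sum, mul_ite, mul_one, mul_zero]
    refine Finset.sum_congr rfl fun j _ => Finset.sum_congr rfl fun k _ => ?_
    rw [Finset.sum_eq_single j]
    · simp
    · intro j' _ h
      simp [h.symm]
    · simp
  have hcol : ∑ k, (∑ j, Q j k) ^ 2 = ∑ r : Fin m × Fin n, ∑ r' : Fin m × Fin n,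
      Q r.1 r.2 * Q r'.1 r'.2 * (if r.2 = r'.2 then 1 else 0) := by
    simp_rw [Fintype.sum_prod_type, sq, Finset.sum_mul_sum, mul_ite, mul_one, mul_zero]
    rw [Finset.sum_comm]
    refine Finset.sum_congr rfl fun j _ => Finset.sum_congr rfl fun k _ =>
      Finset.sum_congr rfl fun j' _ => ?_
    simp
  rw [hM, hrow, hcol, mul_pow, sq (∑ r : Fin m × Fin n, Q r.1 r.2), Finset.sum_mul_sum,
    Finset.mul_sum]
  simp_rw [Finset.mul_sum]
  simp_rw [← Finset.sum_add_distrib]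
  refine Finset.sum_le_sum fun r _ => Finset.sum_le_sum fun r' _ => ?_
  have hq : 0 ≤ Q r.1 r.2 * Q r'.1 r'.2 := mul_nonneg (hQ0 _ _) (hQ0 _ _)
  rw [mul_comm ((2 / Real.pi) ^ 2), ← mul_add, ← mul_add]
  refine mul_le_mul_of_nonneg_left ?_ hq
  split_ifs <;> nlinarith

/-- The variance of the normalized form `absForm Q / d` is small. -/
theorem integral_absForm_div_sub_sq_le {Q : Matrix (Fin m) (Fin n) ℝ}
    (hQ : ∀ j k, Q j k = 0 ∨ Q j k = 1) {b : ℝ} (hb : 0 < b) (hbm : b ≤ m)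
    (hrow : ∀ j, ∑ k, Q j k = b) :
    ∫ p, (absForm Q p / (m * b) - 2 / Real.pi) ^ 2
        ∂((gaussianPi (Fin m)).prod (gaussianPi (Fin n))) ≤ 2 / b := by
  have hQ0 : ∀ j k, 0 ≤ Q j k := fun j k => by rcases hQ j k with h | h <;> simp [h]
  have hQ1 : ∀ j k, Q j k ≤ 1 := fun j k => by rcases hQ j k with h | h <;> simp [h]
  have hm : (0 : ℝ) < m := hb.trans_le hbm
  have hsum : ∑ j, ∑ k, Q j k = m * b := by simp [hrow]
  -- Only the rows have prescribed sums. A column sum is at most `m`, so the squares add up to at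
  -- most `m` times the number of ones.
  have hcol : ∑ k, (∑ j, Q j k) ^ 2 ≤ m * (m * b) := by
    rw [← show ∑ k, ∑ j, Q j k = m * b from Finset.sum_comm.trans hsum, Finset.mul_sum]
    refine Finset.sum_le_sum fun k _ => ?_
    rw [sq]
    refine mul_le_mul_of_nonneg_right ?_ (Finset.sum_nonneg fun j _ => hQ0 j k)
    calc ∑ j, Q j k ≤ ∑ _j : Fin m, (1 : ℝ) := Finset.sum_le_sum fun j _ => hQ1 j k
      _ = m := by simp
  have hrows : ∑ j, (∑ k, Q j k) ^ 2 = m * b ^ 2 := by simp [hrow]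
  have h2 := integral_absForm_sq_le hQ0
  rw [hsum, hrows] at h2
  have e : ∀ p, (absForm Q p / (m * b) - 2 / Real.pi) ^ 2
      = ((m * b) ^ 2)⁻¹ * absForm Q p ^ 2 - 2 * (2 / Real.pi) / (m * b) * absForm Q p
        + (2 / Real.pi) ^ 2 := fun p => by
    have := Real.pi_pos
    field_simp
    ring
  simp_rw [e]
  have hsub : Integrable (fun p => ((m * b) ^ 2)⁻¹ * absForm Q p ^ 2
      - 2 * (2 / Real.pi) / (m * b) * absForm Q p)
      ((gaussianPi (Fin m)).prod (gaussianPi (Fin n))) :=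
    ((integrable_absForm_sq Q).const_mul _).sub ((integrable_absForm Q).const_mul _)
  rw [integral_add hsub (integrable_const _),
    integral_sub ((integrable_absForm_sq Q).const_mul _) ((integrable_absForm Q).const_mul _),
    integral_const_mul, integral_const_mul, integral_absForm, hsum, integral_const]
  simp only [probReal_univ, one_smul]
  have hpi := Real.pi_pos
  have h3 : ((m * b) ^ 2)⁻¹ * (∫ p, absForm Q p ^ 2
      ∂((gaussianPi (Fin m)).prod (gaussianPi (Fin n))))
      ≤ ((m * b) ^ 2)⁻¹ * ((2 / Real.pi * (m * b)) ^ 2 + (m * b ^ 2 + m * (m * b))) :=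
    mul_le_mul_of_nonneg_left (by linarith) (by positivity)
  have h4 : ((m * b) ^ 2)⁻¹ * ((2 / Real.pi * (m * b)) ^ 2 + (m * b ^ 2 + m * (m * b)))
      = (2 / Real.pi) ^ 2 + (1 / m + 1 / b) := by
    field_simp
  have h5 : 2 * (2 / Real.pi) / (m * b) * (2 / Real.pi * (m * b)) = 2 * (2 / Real.pi) ^ 2 := by
    field_simp
  have h6 : 1 / (m : ℝ) ≤ 1 / b := one_div_le_one_div_of_le hb hbm
  have h7 : 2 / b = 1 / b + 1 / b := by ring
  linarith

end Moments

/-! ### Laplace transforms of concentrated variables -/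

section Laplace

variable {α : Type*} [MeasurableSpace α] {ν : Measure α} [IsProbabilityMeasure ν] {X : α → ℝ}
  {μ V : ℝ}

theorem exp_le_one_add_add_sq_mul_exp {u B : ℝ} (hu : u ≤ B) (hB : 0 ≤ B) :
    Real.exp u ≤ 1 + u + u ^ 2 * Real.exp B := by
  have h1 : 1 - u ≤ Real.exp (-u) := by linarith [Real.add_one_le_exp (-u)]
  have he : Real.exp u * Real.exp (-u) = 1 := by rw [← Real.exp_add]; simp
  have hpos := Real.exp_pos u
  have hB1 : 1 ≤ Real.exp B := Real.one_le_exp hB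
  rcases le_total u 0 with h | h
  · have h2 : Real.exp u * (1 - u) ≤ 1 := by nlinarith
    have h3 : Real.exp u ≤ 1 + u + u ^ 2 := by
      -- The product equals `1 - u ^ 3`.
      have h4 : 1 ≤ (1 + u + u ^ 2) * (1 - u) := by nlinarith [mul_nonneg (sq_nonneg u) (neg_nonneg.2 h)]
      exact le_of_mul_le_mul_right (h2.trans h4) (by linarith)
    nlinarith [sq_nonneg u]
  · have h2 : Real.exp u ≤ 1 + u * Real.exp u := by nlinarith
    have h3 : Real.exp u ≤ 1 + u + u ^ 2 * Real.exp u := by nlinarith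
    have h4 : Real.exp u ≤ Real.exp B := Real.exp_le_exp.2 hu
    nlinarith [sq_nonneg u]

theorem integrable_exp_neg_mul (hXm : AEMeasurable X ν) (hX0 : ∀ x, 0 ≤ X x) {t : ℝ}
    (ht : 0 ≤ t) : Integrable (fun x => Real.exp (-t * X x)) ν := by
  refine (integrable_const (1 : ℝ)).mono' (by fun_prop) (Eventually.of_forall fun x => ?_)
  rw [Real.norm_of_nonneg (Real.exp_nonneg _), Real.exp_le_one_iff]
  nlinarith [hX0 x]

/-- Two-sided bounds for a Laplace transform in terms of the mean and the variance. -/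
theorem integral_exp_neg_mul_bounds (hX : Integrable X ν) (hX0 : ∀ x, 0 ≤ X x)
    (hmean : ∫ x, X x ∂ν = μ) (hX2 : Integrable (fun x => (X x - μ) ^ 2) ν)
    (hV : ∫ x, (X x - μ) ^ 2 ∂ν ≤ V) {t : ℝ} (ht : 0 ≤ t) :
    Real.exp (-t * μ) ≤ ∫ x, Real.exp (-t * X x) ∂ν ∧
    ∫ x, Real.exp (-t * X x) ∂ν ≤ Real.exp (-t * μ) * (1 + t ^ 2 * Real.exp (t * μ) * V) := by
  have hμ : 0 ≤ μ := hmean ▸ integral_nonneg hX0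
  have hI := integrable_exp_neg_mul hX.1.aemeasurable hX0 ht
  have hfac : ∀ x, Real.exp (-t * X x) = Real.exp (-t * μ) * Real.exp (-t * (X x - μ)) := by
    intro x
    rw [← Real.exp_add]
    ring_nf
  have hc : Integrable (fun x => X x - μ) ν := hX.sub (integrable_const _)
  have hc0 : ∫ x, (X x - μ) ∂ν = 0 := by
    rw [integral_sub hX (integrable_const _), hmean]
    simp
  constructor
  -- Jensen's inequality, through the tangent line at the mean: the linear term integrates to zero.
  · have hi : Integrable (fun x => Real.exp (-t * μ) * (1 + -t * (X x - μ))) ν :=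
      ((integrable_const _).add (hc.const_mul _)).const_mul _
    have h : ∫ x, Real.exp (-t * μ) * (1 + -t * (X x - μ)) ∂ν ≤ ∫ x, Real.exp (-t * X x) ∂ν := by
      refine integral_mono hi hI fun x => ?_
      rw [hfac]
      refine mul_le_mul_of_nonneg_left ?_ (Real.exp_nonneg _)
      linarith [Real.add_one_le_exp (-t * (X x - μ))]
    rw [integral_const_mul, integral_add (integrable_const _) (hc.const_mul _),
      integral_const_mul, hc0] at h
    simpa using h
  · have hi : Integrable (fun x => Real.exp (-t * μ) *
        (1 + -t * (X x - μ) + t ^ 2 * Real.exp (t * μ) * (X x - μ) ^ 2)) ν :=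
      (((integrable_const _).add (hc.const_mul _)).add (hX2.const_mul _)).const_mul _
    have h : ∫ x, Real.exp (-t * X x) ∂ν ≤ ∫ x, Real.exp (-t * μ) *
        (1 + -t * (X x - μ) + t ^ 2 * Real.exp (t * μ) * (X x - μ) ^ 2) ∂ν := by
      refine integral_mono hI hi fun x => ?_
      simp only
      rw [hfac]
      refine mul_le_mul_of_nonneg_left ?_ (Real.exp_nonneg _)
      -- Nonnegativity of `X` bounds the exponent above, which is what the quadratic estimate needs.
      have h1 : -t * (X x - μ) ≤ t * μ := by nlinarith [mul_nonneg ht (hX0 x)]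
      have := exp_le_one_add_add_sq_mul_exp h1 (mul_nonneg ht hμ)
      linarith [this, show (-t * (X x - μ)) ^ 2 * Real.exp (t * μ)
        = t ^ 2 * Real.exp (t * μ) * (X x - μ) ^ 2 by ring]
    rw [integral_const_mul, integral_add (Integrable.fun_add (integrable_const _) (hc.const_mul _))
      (hX2.const_mul _), integral_add (integrable_const _) (hc.const_mul _), integral_const_mul,
      integral_const_mul, hc0] at h
    simp only [integral_const, probReal_univ, one_smul, mul_zero, add_zero] at h
    refine h.trans (mul_le_mul_of_nonneg_left ?_ (Real.exp_nonneg _))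
    have := mul_le_mul_of_nonneg_left hV (show 0 ≤ t ^ 2 * Real.exp (t * μ) by positivity)
    linarith

theorem norm_exp_neg_mul_sub_le {w : ℂ} (hw : w ∈ halfPlane) {x y : ℝ} (hx : 0 ≤ x) (hy : 0 ≤ y) :
    ‖Complex.exp (-w * x) - Complex.exp (-w * y)‖ ≤ ‖w‖ * |x - y| := by
  have hd : ∀ s ∈ Set.Ici (0 : ℝ), HasDerivWithinAt (fun s : ℝ => Complex.exp (-w * s))
      (Complex.exp (-w * s) * (-w)) (Set.Ici 0) s := by
    intro s _
    have h : HasDerivAt (fun u : ℂ => -w * u) (-w) (s : ℂ) := by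
      simpa using (hasDerivAt_id (s : ℂ)).const_mul (-w)
    exact (h.cexp.comp_ofReal).hasDerivWithinAt
  have hb : ∀ s ∈ Set.Ici (0 : ℝ), ‖Complex.exp (-w * s) * (-w)‖ ≤ ‖w‖ := by
    intro s hs
    rw [norm_mul, norm_neg]
    exact mul_le_of_le_one_left (norm_nonneg _) (norm_exp_neg_mul_le_one hw hs)
  have := (convex_Ici (0 : ℝ)).norm_image_sub_le_of_norm_hasDerivWithin_le hd hb
    (show y ∈ Set.Ici (0 : ℝ) from hy) (show x ∈ Set.Ici (0 : ℝ) from hx)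
  simpa using this

/-- The Lipschitz bound is combined with `|x - μ| ≤ δ + (x - μ)² / δ`; the free parameter `δ` is
later balanced against the variance. -/
theorem norm_integral_exp_neg_mul_sub_le (hX : Integrable X ν) (hX0 : ∀ x, 0 ≤ X x) (hμ : 0 ≤ μ)
    (hX2 : Integrable (fun x => (X x - μ) ^ 2) ν) (hV : ∫ x, (X x - μ) ^ 2 ∂ν ≤ V) {δ : ℝ}
    (hδ : 0 < δ) {w : ℂ} (hw : w ∈ halfPlane) :
    ‖∫ x, Complex.exp (-w * X x) ∂ν - Complex.exp (-w * μ)‖ ≤ ‖w‖ * (δ + V / δ) := by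
  have hi : Integrable (fun x => Complex.exp (-w * X x)) ν := by
    have hm := hX.1.aemeasurable
    exact (integrable_const (1 : ℝ)).mono' (by fun_prop)
      (Eventually.of_forall fun x => norm_exp_neg_mul_le_one hw (hX0 x))
  have h1 : ∫ x, Complex.exp (-w * X x) ∂ν - Complex.exp (-w * μ)
      = ∫ x, (Complex.exp (-w * X x) - Complex.exp (-w * μ)) ∂ν := by
    rw [integral_sub hi (integrable_const _)]
    simp
  have hbd : Integrable (fun x => ‖w‖ * (δ + (X x - μ) ^ 2 / δ)) ν :=
    ((integrable_const _).add (hX2.div_const _)).const_mul _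
  rw [h1]
  refine (norm_integral_le_of_norm_le hbd (Eventually.of_forall fun x => ?_)).trans ?_
  · refine (norm_exp_neg_mul_sub_le hw (hX0 x) hμ).trans
      (mul_le_mul_of_nonneg_left ?_ (norm_nonneg _))
    rw [← sub_le_iff_le_add', le_div_iff₀ hδ, ← sq_abs (X x - μ)]
    nlinarith [sq_nonneg (|X x - μ| - δ), abs_nonneg (X x - μ)]
  · rw [integral_const_mul, integral_add (integrable_const _) (hX2.div_const _), integral_div]
    simp only [integral_const, probReal_univ, one_smul]
    gcongr

end Laplace

/-! ### Transfer to the given probability space -/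

section Transfer

variable {Ω : Type*} [MeasurableSpace Ω] {P : Measure Ω} {m n : ℕ}
  {Q : Matrix (Fin m) (Fin n) ℝ} {a : Fin m → Fin n → Ω → ℝ}

theorem aemeasurable_entries (ha : ∀ j k, HasLaw (a j k) (cauchyMeasure 0 1) P) :
    AEMeasurable (fun ω (p : Fin m × Fin n) => a p.1 p.2 ω) P :=
  aemeasurable_pi_lambda _ fun p => (ha p.1 p.2).aemeasurable

theorem map_entries (ha : ∀ j k, HasLaw (a j k) (cauchyMeasure 0 1) P)
    (hindep : iIndepFun (fun p : Fin m × Fin n => a p.1 p.2) P) :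
    P.map (fun ω (p : Fin m × Fin n) => a p.1 p.2 ω) = cauchyPi m n := by
  refine (hindep.map_fun_eq_pi_map fun p : Fin m × Fin n => (ha p.1 p.2).aemeasurable).trans ?_
  congr
  funext p
  exact (ha p.1 p.2).map_eq

theorem integrable_invSqrtDet_sparse [IsProbabilityMeasure P]
    (Q : Matrix (Fin m) (Fin n) ℝ)
    (ha : ∀ j k, HasLaw (a j k) (cauchyMeasure 0 1) P) {c : ℝ} (hc : 0 ≤ c) {z : ℂ}
    (hz : z ∈ halfPlane) :
    Integrable (fun ω => invSqrtDet ((1 / c) • ((sparse Q a ω)ᵀ * sparse Q a ω)) z) P :=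
  (integrable_const (1 : ℝ)).mono'
    ((stronglyMeasurable_invSqrtDet_sparseArray Q hc hz).measurable.comp_aemeasurable
      (aemeasurable_entries ha)).aestronglyMeasurable
    (Eventually.of_forall fun _ => norm_invSqrtDet_le_one _ hc hz)

theorem integral_invSqrtDet_sparse (hQ : ∀ j k, 0 ≤ Q j k)
    (ha : ∀ j k, HasLaw (a j k) (cauchyMeasure 0 1) P)
    (hindep : iIndepFun (fun p : Fin m × Fin n => a p.1 p.2) P) {d : ℝ} (hd : 0 ≤ d) {z : ℂ}
    (hz : z ∈ halfPlane) :
    ∫ ω, invSqrtDet ((1 / d ^ 2) • ((sparse Q a ω)ᵀ * sparse Q a ω)) z ∂P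
      = ∫ p, Complex.exp (-z ^ (1 / 2 : ℂ) * ((absForm Q p / d : ℝ) : ℂ))
          ∂((gaussianPi (Fin m)).prod (gaussianPi (Fin n))) := by
  rw [← integral_cauchyPi_invSqrtDet hQ hd hz, ← map_entries ha hindep,
    integral_map (aemeasurable_entries ha)
      (stronglyMeasurable_invSqrtDet_sparseArray Q (sq_nonneg d) hz).aestronglyMeasurable]
  rfl

theorem measurable_det_rpow_sparseArray (Q : Matrix (Fin m) (Fin n) ℝ) (s : ℝ) :
    Measurable fun y => (1 + s • ((sparseArray Q y)ᵀ * sparseArray Q y)).det ^ (-1 / 2 : ℝ) := by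
  have hs : Continuous fun y => sparseArray Q y := by
    refine continuous_matrix fun j k => ?_
    simp only [sparseArray, sparse, Matrix.of_apply]
    fun_prop
  have : Continuous fun y => (1 + s • ((sparseArray Q y)ᵀ * sparseArray Q y)).det := by fun_prop
  exact this.measurable.pow_const _

theorem det_rpow_mem_Icc (G : Matrix (Fin m) (Fin n) ℝ) {s : ℝ} (hs : 0 ≤ s) :
    (1 + s • (Gᵀ * G)).det ^ (-1 / 2 : ℝ) ∈ Set.Icc 0 1 := by
  rw [det_one_add_smul_gram_rpow G hs]
  have h : ∀ i, 1 ≤ 1 + s * gramEigenvalues G i := fun i => by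
    have := mul_nonneg hs (gramEigenvalues_nonneg G i)
    linarith
  have h0 : ∀ i, 0 ≤ (1 + s * gramEigenvalues G i) ^ (-1 / 2 : ℝ) := fun i =>
    Real.rpow_nonneg (zero_le_one.trans (h i)) _
  exact ⟨Finset.prod_nonneg fun i _ => h0 i, Finset.prod_le_one (fun i _ => h0 i) fun i _ =>
    Real.rpow_le_one_of_one_le_of_nonpos (h i) (by norm_num)⟩

theorem integrable_det_rpow_sparse [IsProbabilityMeasure P]
    (Q : Matrix (Fin m) (Fin n) ℝ)
    (ha : ∀ j k, HasLaw (a j k) (cauchyMeasure 0 1) P) {s : ℝ} (hs : 0 ≤ s) :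
    Integrable
      (fun ω => (1 + s • ((sparse Q a ω)ᵀ * sparse Q a ω)).det ^ (-1 / 2 : ℝ)) P := by
  refine (integrable_const (1 : ℝ)).mono'
    ((measurable_det_rpow_sparseArray Q s).comp_aemeasurable
      (aemeasurable_entries ha)).aestronglyMeasurable (Eventually.of_forall fun ω => ?_)
  have h := det_rpow_mem_Icc (sparse Q a ω) hs
  rw [Real.norm_of_nonneg h.1]
  exact h.2

theorem integral_det_rpow_sparse (hQ : ∀ j k, 0 ≤ Q j k)
    (ha : ∀ j k, HasLaw (a j k) (cauchyMeasure 0 1) P)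
    (hindep : iIndepFun (fun p : Fin m × Fin n => a p.1 p.2) P) {d : ℝ} (hd : 0 ≤ d) {t : ℝ}
    (ht : 0 ≤ t) :
    ∫ ω, (1 + (t ^ 2 / d ^ 2) • ((sparse Q a ω)ᵀ * sparse Q a ω)).det ^ (-1 / 2 : ℝ) ∂P
      = ∫ p, Real.exp (-t * (absForm Q p / d))
          ∂((gaussianPi (Fin m)).prod (gaussianPi (Fin n))) := by
  have h := integral_cauchyPi_det_rpow hQ (s := t / d) (div_nonneg ht hd)
  rw [div_pow, ← map_entries ha hindep, integral_map (aemeasurable_entries ha)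
    (measurable_det_rpow_sparseArray Q _).aestronglyMeasurable] at h
  refine h.trans ?_
  congr with p
  congr 1
  ring

end Transfer

/-! ### Row sums of the 0-1 matrix -/

section Rows

variable {m n : ℕ} {Q : Matrix (Fin m) (Fin n) ℝ} {b : ℕ}

theorem sum_row_eq (hQ : ∀ j k, Q j k = 0 ∨ Q j k = 1) (hQb : ∀ j, {k | Q j k ≠ 0}.ncard = b)
    (j : Fin m) : ∑ k, Q j k = b := by
  classical
  have h : ∀ k, Q j k = if Q j k ≠ 0 then 1 else 0 := fun k => by
    rcases hQ j k with h | h <;> simp [h]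
  rw [Finset.sum_congr rfl fun k _ => h k, Finset.sum_boole, ← hQb j,
    Set.ncard_eq_toFinset_card']
  congr 2
  ext k
  simp

theorem nonzero_count_le (hm : 0 < m) (hQb : ∀ j, {k | Q j k ≠ 0}.ncard = b) : b ≤ n := by
  rw [← hQb ⟨0, hm⟩]
  simpa using Set.ncard_le_card {k | Q ⟨0, hm⟩ k ≠ 0}

end Rows

/-! ### Quantitative bounds for the Gaussian average -/

section Estimates

variable {m n : ℕ} {Q : Matrix (Fin m) (Fin n) ℝ} {b : ℝ}

theorem integrable_absForm_div_sub_sq (Q : Matrix (Fin m) (Fin n) ℝ) (d μ : ℝ) :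
    Integrable (fun p => (absForm Q p / d - μ) ^ 2)
      ((gaussianPi (Fin m)).prod (gaussianPi (Fin n))) := by
  have e : ∀ p, (absForm Q p / d - μ) ^ 2
      = (d⁻¹) ^ 2 * absForm Q p ^ 2 - 2 * μ * d⁻¹ * absForm Q p + μ ^ 2 := fun p => by ring
  simp_rw [e]
  exact (((integrable_absForm_sq Q).const_mul _).sub
    ((integrable_absForm Q).const_mul _)).add (integrable_const _)

theorem norm_integral_exp_absForm_sub_le (hQ : ∀ j k, Q j k = 0 ∨ Q j k = 1) (hb : 0 < b)
    (hbm : b ≤ m) (hrow : ∀ j, ∑ k, Q j k = b) {w : ℂ} (hw : w ∈ halfPlane) :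
    ‖∫ p, Complex.exp (-w * ((absForm Q p / (m * b) : ℝ) : ℂ))
        ∂((gaussianPi (Fin m)).prod (gaussianPi (Fin n))) - Complex.exp (-w * (2 / Real.pi : ℝ))‖
      ≤ 3 * ‖w‖ / √b := by
  have hQ0 : ∀ j k, 0 ≤ Q j k := fun j k => by rcases hQ j k with h | h <;> simp [h]
  have hs : 0 < √b := Real.sqrt_pos.2 hb
  refine (norm_integral_exp_neg_mul_sub_le ((integrable_absForm Q).div_const _)
    (fun p => div_nonneg (absForm_nonneg hQ0 p) (by positivity))
    (show 0 ≤ 2 / Real.pi by have := Real.pi_pos; positivity)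
    (integrable_absForm_div_sub_sq Q _ _) (integral_absForm_div_sub_sq_le hQ hb hbm hrow)
    -- With `δ = 1/√b` and variance bound `2/b`, `δ + V/δ` equals `3/√b`.
    (inv_pos.2 hs) hw).trans_eq ?_
  have h2 : √b ^ 2 = b := Real.sq_sqrt hb.le
  rw [← h2, Real.sqrt_sq hs.le]
  field_simp
  ring

theorem integral_exp_absForm_bounds (hQ : ∀ j k, Q j k = 0 ∨ Q j k = 1) (hb : 0 < b)
    (hbm : b ≤ m) (hrow : ∀ j, ∑ k, Q j k = b) {t : ℝ} (ht : 0 ≤ t) :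
    Real.exp (-t * (2 / Real.pi)) ≤ ∫ p, Real.exp (-t * (absForm Q p / (m * b)))
        ∂((gaussianPi (Fin m)).prod (gaussianPi (Fin n))) ∧
    ∫ p, Real.exp (-t * (absForm Q p / (m * b)))
        ∂((gaussianPi (Fin m)).prod (gaussianPi (Fin n)))
      ≤ Real.exp (-t * (2 / Real.pi)) * (1 + t ^ 2 * Real.exp (t * (2 / Real.pi)) * (2 / b)) := by
  have hQ0 : ∀ j k, 0 ≤ Q j k := fun j k => by rcases hQ j k with h | h <;> simp [h]
  have hm : (0 : ℝ) < m := hb.trans_le hbm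
  refine integral_exp_neg_mul_bounds ((integrable_absForm Q).div_const _)
    (fun p => div_nonneg (absForm_nonneg hQ0 p) (by positivity)) ?_
    (integrable_absForm_div_sub_sq Q _ _) (integral_absForm_div_sub_sq_le hQ hb hbm hrow) ht
  rw [integral_div, integral_absForm]
  simp only [hrow, Finset.sum_const, Finset.card_univ, Fintype.card_fin, nsmul_eq_mul]
  field_simp

/-- The relative error in the exponent, given two-sided bounds on the exponential. -/
theorem abs_neg_log_div_sub_one_le {L μ t x : ℝ} (hμ : 0 < μ) (ht : 0 < t) (hx : 0 ≤ x)
    (h1 : Real.exp (-t * μ) ≤ L) (h2 : L ≤ Real.exp (-t * μ) * (1 + t * x)) :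
    |-Real.log L / (μ * t) - 1| ≤ x / μ := by
  have hL : 0 < L := (Real.exp_pos _).trans_le h1
  have hl1 : -t * μ ≤ Real.log L := (Real.le_log_iff_exp_le hL).2 h1
  have hpos : 0 < 1 + t * x := by positivity
  have hl2 : Real.log L ≤ -t * μ + t * x := by
    have h3 := Real.log_le_log hL h2
    rw [Real.log_mul (Real.exp_pos _).ne' hpos.ne', Real.log_exp] at h3
    linarith [Real.log_le_sub_one_of_pos hpos]
  have e : -Real.log L / (μ * t) - 1 = -((Real.log L + t * μ) / (μ * t)) := by
    field_simp
    ring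
  rw [e, abs_neg, abs_of_nonneg (div_nonneg (by linarith) (by positivity)),
    div_le_div_iff₀ (by positivity) hμ]
  nlinarith

end Estimates

end CauchyMatrix

/-! ### The main theorem -/

theorem theorem1p2
    {Ω : ℕ → Type*} [∀ n, MeasurableSpace (Ω n)]
    (P : ∀ n, Measure (Ω n)) [∀ n, IsProbabilityMeasure (P n)]
    -- the dimensions `m = m n ≥ n` and the number `b n` of nonzero entries
    (m b : ℕ → ℕ) (hm : ∀ n, n ≤ m n)
    (α : ℝ) (hα : 0 < α) (hα1 : α ≤ 1) (hb : ∀ n : ℕ, (n : ℝ) ^ α ≤ b n)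
    (hlog : ∀ δ : ℝ, 0 < δ →
      (fun n : ℕ => Real.log (m n)) =o[atTop] fun n : ℕ => (n : ℝ) ^ δ)
    -- the fixed 0-1 matrices
    (Q : ∀ n, Matrix (Fin (m n)) (Fin n) ℝ)
    (hQ : ∀ n j k, Q n j k = 0 ∨ Q n j k = 1)
    (hQb : ∀ n j, {k | Q n j k ≠ 0}.ncard = b n)
    -- i.i.d. standard Cauchy random variables
    (a : ∀ n, Fin (m n) → Fin n → Ω n → ℝ)
    (ha : ∀ n j k, HasLaw (a n j k) (cauchyMeasure 0 1) (P n))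
    (hindep : ∀ n, iIndepFun (fun p : Fin (m n) × Fin n => a n p.1 p.2) (P n))
    -- a Poisson process with intensity `1 / (π x ^ (3/2))` on the positive half-axis
    {Ω' : Type*} [MeasurableSpace Ω'] (P' : Measure Ω') [IsProbabilityMeasure P']
    (ξ : ℕ → Ω' → ℝ) (hξ : CauchyMatrix.IsPoissonProcess P' CauchyMatrix.intensity ξ) :
    let Γ : ∀ n, Ω n → Matrix (Fin (m n)) (Fin n) ℝ := fun n => CauchyMatrix.sparse (Q n) (a n)
    let c : ℕ → ℝ := fun n => (m n : ℝ) ^ 2 * (b n : ℝ) ^ 2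
    let ev : ∀ n, Ω n → Fin n → ℝ := fun n ω i => CauchyMatrix.gramEigenvalues (Γ n ω) i / c n
    let detPow : ∀ n, ℂ → Ω n → ℂ := fun n z ω =>
      CauchyMatrix.invSqrtDet ((1 / c n) • ((Γ n ω)ᵀ * Γ n ω)) z
    -- the determinant and the eigenvalue product define the same integrable random variable
    (∀ n, ∀ z ∈ CauchyMatrix.halfPlane,
      (∀ ω, detPow n z ω = ∏ i, (1 + z * (ev n ω i : ℂ)) ^ (-1 / 2 : ℂ)) ∧
      Integrable (detPow n z) (P n) ∧
      ∫ ω, detPow n z ω ∂(P n) = ∫ ω, ∏ i, (1 + z * (ev n ω i : ℂ)) ^ (-1 / 2 : ℂ) ∂(P n)) ∧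
    -- the limit, uniform on compact subsets of the half-plane
    (∀ K ⊆ CauchyMatrix.halfPlane, IsCompact K →
      TendstoUniformlyOn (fun n z => ∫ ω, detPow n z ω ∂(P n))
        (fun z => Complex.exp (-(2 / Real.pi) * z ^ (1 / 2 : ℂ))) atTop K) ∧
    -- the limit as an expectation over the Poisson process
    (∀ z ∈ CauchyMatrix.halfPlane,
      (∀ᵐ ω ∂P', Multipliable fun i => (1 + z * (ξ i ω : ℂ)) ^ (-1 / 2 : ℂ)) ∧
      Integrable (fun ω => ∏' i, (1 + z * (ξ i ω : ℂ)) ^ (-1 / 2 : ℂ)) P' ∧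
      Complex.exp (-(2 / Real.pi) * z ^ (1 / 2 : ℂ))
        = ∫ ω, ∏' i, (1 + z * (ξ i ω : ℂ)) ^ (-1 / 2 : ℂ) ∂P') ∧
    -- the rate of convergence at `z = t ^ 2`
    ∃ err : ℕ → ℝ → ℝ,
      (∀ n, ∀ t : ℝ, 0 ≤ t →
        Integrable
          (fun ω => (1 + (t ^ 2 / c n) • ((Γ n ω)ᵀ * Γ n ω)).det ^ (-1 / 2 : ℝ)) (P n) ∧
        ∫ ω, (1 + (t ^ 2 / c n) • ((Γ n ω)ᵀ * Γ n ω)).det ^ (-1 / 2 : ℝ) ∂(P n)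
          = ∫ ω, ∏ i, (1 + t ^ 2 * ev n ω i) ^ (-1 / 2 : ℝ) ∂(P n) ∧
        ∫ ω, (1 + (t ^ 2 / c n) • ((Γ n ω)ᵀ * Γ n ω)).det ^ (-1 / 2 : ℝ) ∂(P n)
          = Real.exp (-(2 / Real.pi) * t * (1 + err n t))) ∧
      ∀ ε : ℝ, 0 < ε → ∀ K ⊆ Set.Ici (0 : ℝ), IsCompact K →
        TendstoUniformlyOn (fun n t => err n t / (b n : ℝ) ^ (-1 / 2 + ε)) (fun _ => 0) atTop K := by
  intro Γ c ev detPow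
  have hc : ∀ n, c n = ((m n : ℝ) * b n) ^ 2 := fun n => (mul_pow _ _ _).symm
  have hd : ∀ n, (0 : ℝ) ≤ (m n : ℝ) * b n := fun n => by positivity
  have hc0 : ∀ n, 0 ≤ c n := fun n => by rw [hc]; positivity
  have hQ0 : ∀ n j k, 0 ≤ Q n j k := fun n j k => by rcases hQ n j k with h | h <;> simp [h]
  have hmpos : ∀ n, 1 ≤ n → 0 < m n := fun n hn => lt_of_lt_of_le hn (hm n)
  have hbpos : ∀ n, 1 ≤ n → (0 : ℝ) < b n := fun n hn =>
    (Real.rpow_pos_of_pos (by exact_mod_cast hn) α).trans_le (hb n)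
  have hbm : ∀ n, 1 ≤ n → (b n : ℝ) ≤ m n := fun n hn => by
    exact_mod_cast (CauchyMatrix.nonzero_count_le (hmpos n hn) (hQb n)).trans (hm n)
  have hrow : ∀ n j, ∑ k, Q n j k = (b n : ℝ) := fun n =>
    CauchyMatrix.sum_row_eq (hQ n) (hQb n)
  have hbtop : Tendsto (fun n => (b n : ℝ)) atTop atTop :=
    tendsto_atTop_mono hb ((tendsto_rpow_atTop hα).comp tendsto_natCast_atTop_atTop)
  have hpi := Real.pi_pos
  refine ⟨fun n z hz => ?_, fun K hK hKc => ?_, fun z hz => hξ.integral_tprod_cpow_neg_half hz, ?_⟩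
  · have h1 : ∀ ω, detPow n z ω = ∏ i, (1 + z * (ev n ω i : ℂ)) ^ (-1 / 2 : ℂ) := fun ω =>
      CauchyMatrix.invSqrtDet_eq_prod (Γ n ω) (hc0 n) hz
    exact ⟨h1, CauchyMatrix.integrable_invSqrtDet_sparse (Q n) (ha n) (hc0 n) hz,
      integral_congr_ae (Eventually.of_forall h1)⟩
  · obtain ⟨R, hR⟩ := hKc.isBounded.exists_norm_le
    have hlim : Tendsto (fun n => 3 * (1 + R) / √(b n : ℝ)) atTop (𝓝 0) :=
      (Real.tendsto_sqrt_atTop.comp hbtop).const_div_atTop _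
    rw [Metric.tendstoUniformlyOn_iff]
    intro δ hδ
    filter_upwards [hlim.eventually (gt_mem_nhds hδ), eventually_ge_atTop 1] with n hn hn1 z hz
    have hzD := hK hz
    have hw : z ^ (1 / 2 : ℂ) ∈ CauchyMatrix.halfPlane := CauchyMatrix.re_cpow_half_pos hzD
    -- From `‖√z‖² = ‖z‖ ≤ R` and `2x ≤ 1 + x²`.
    have hwR : ‖z ^ (1 / 2 : ℂ)‖ ≤ 1 + R := by
      have h1 : ‖z ^ (1 / 2 : ℂ)‖ ^ 2 ≤ R := by
        rw [← norm_pow, CauchyMatrix.cpow_half_sq]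
        exact hR z hz
      nlinarith [sq_nonneg (‖z ^ (1 / 2 : ℂ)‖ - 1), norm_nonneg (z ^ (1 / 2 : ℂ))]
    have hint := CauchyMatrix.integral_invSqrtDet_sparse (hQ0 n) (ha n) (hindep n) (hd n) hzD
    have hb' := CauchyMatrix.norm_integral_exp_absForm_sub_le (hQ n) (hbpos n hn1) (hbm n hn1)
      (hrow n) hw
    have hexp : Complex.exp (-(2 / Real.pi) * z ^ (1 / 2 : ℂ))
        = Complex.exp (-z ^ (1 / 2 : ℂ) * (2 / Real.pi : ℝ)) := by
      push_cast
      ring_nf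
    rw [← hint, ← hc n] at hb'
    rw [dist_comm, dist_eq_norm, hexp]
    refine lt_of_le_of_lt (le_trans hb' ?_) hn
    gcongr
  · set L : ℕ → ℝ → ℝ := fun n t =>
      ∫ ω, (1 + (t ^ 2 / c n) • ((Γ n ω)ᵀ * Γ n ω)).det ^ (-1 / 2 : ℝ) ∂(P n) with hL
    have hLeq : ∀ n t, 0 ≤ t → L n t = ∫ p, Real.exp (-t * (CauchyMatrix.absForm (Q n) p /
        (m n * b n))) ∂((CauchyMatrix.gaussianPi (Fin (m n))).prod
          (CauchyMatrix.gaussianPi (Fin n))) := fun n t ht => by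
      have h := CauchyMatrix.integral_det_rpow_sparse (hQ0 n) (ha n) (hindep n) (hd n) ht
      rw [← hc n] at h
      exact h
    have hLpos : ∀ n t, 0 ≤ t → 0 < L n t := fun n t ht => by
      rw [hLeq n t ht]
      exact integral_exp_pos (CauchyMatrix.integrable_exp_neg_mul
        ((CauchyMatrix.continuous_absForm (Q n)).div_const _).aemeasurable
        (fun p => div_nonneg (CauchyMatrix.absForm_nonneg (hQ0 n) p) (hd n)) ht)
    -- The error is obtained by solving the required identity. At `t = 0` both sides are `1`
    -- whatever the error is, and the value `0` keeps the bound uniform there.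
    refine ⟨fun n t => if t = 0 then 0 else -Real.log (L n t) / (2 / Real.pi * t) - 1,
      fun n t ht => ⟨?_, ?_, ?_⟩, fun ε hε K hK hKc => ?_⟩
    · exact CauchyMatrix.integrable_det_rpow_sparse (Q n) (ha n) (div_nonneg (sq_nonneg t) (hc0 n))
    · refine integral_congr_ae (Eventually.of_forall fun ω => ?_)
      refine (CauchyMatrix.det_one_add_smul_gram_rpow (Γ n ω)
        (div_nonneg (sq_nonneg t) (hc0 n))).trans (Finset.prod_congr rfl fun i _ => ?_)
      simp only [ev]
      congr 2
      ring
    · change L n t = _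
      beta_reduce
      split_ifs with h0
      · subst h0
        rw [hLeq n 0 le_rfl]
        simp
      · have e : -(2 / Real.pi) * t * (1 + (-Real.log (L n t) / (2 / Real.pi * t) - 1))
            = Real.log (L n t) := by
          field_simp
          ring
        rw [e, Real.exp_log (hLpos n t ht)]
    · obtain ⟨T, hT⟩ := hKc.isBounded.exists_norm_le
      -- This bounds `t exp (2t/π) · 2 / (2/π)` on `[0, T]`, so that the error is at most `C / b n`;
      -- dividing by `b ^ (-1/2 + ε)` leaves `C b ^ (-(1/2 + ε))`.
      set C : ℝ := T * Real.exp (T * (2 / Real.pi)) * Real.pi with hC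
      have hlim : Tendsto (fun n => C * (b n : ℝ) ^ (-(1 / 2 + ε))) atTop (𝓝 0) := by
        have h := ((tendsto_rpow_neg_atTop (show 0 < 1 / 2 + ε by positivity)).comp
          hbtop).const_mul C
        rwa [mul_zero] at h
      rw [Metric.tendstoUniformlyOn_iff]
      intro δ hδ
      filter_upwards [hlim.eventually (gt_mem_nhds hδ), eventually_ge_atTop 1] with n hn hn1 t ht
      have hb0 := hbpos n hn1
      have ht0 : 0 ≤ t := hK ht
      have htT : t ≤ T := (le_abs_self t).trans (hT t ht)
      have hT0 : 0 ≤ T := ht0.trans htT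
      have hCb : 0 ≤ C / b n := by positivity
      have herr : |if t = 0 then 0 else -Real.log (L n t) / (2 / Real.pi * t) - 1| ≤ C / b n := by
        split_ifs with h0
        · simpa using hCb
        · have htpos : 0 < t := lt_of_le_of_ne ht0 (Ne.symm h0)
          obtain ⟨h1, h2⟩ := CauchyMatrix.integral_exp_absForm_bounds (hQ n) hb0 (hbm n hn1)
            (hrow n) ht0
          rw [← hLeq n t ht0] at h1 h2
          -- One factor of `t²` is split off to cancel the `t` in the denominator of the relative
          -- error, so nothing blows up as `t → 0`.
          refine (CauchyMatrix.abs_neg_log_div_sub_one_le (by positivity) htpos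
            (x := t * Real.exp (t * (2 / Real.pi)) * (2 / b n)) (by positivity) h1
            (h2.trans_eq (by ring))).trans ?_
          have e : t * Real.exp (t * (2 / Real.pi)) * (2 / b n) / (2 / Real.pi)
              = t * Real.exp (t * (2 / Real.pi)) * Real.pi / b n := by
            field_simp
          rw [e, hC]
          gcongr
      rw [dist_zero_left, norm_div, Real.norm_eq_abs,
        Real.norm_of_nonneg (Real.rpow_nonneg hb0.le _)]
      refine lt_of_le_of_lt ?_ hn
      rw [div_le_iff₀ (Real.rpow_pos_of_pos hb0 _), mul_assoc, ← Real.rpow_add hb0,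
        show -(1 / 2 + ε) + (-1 / 2 + ε) = -1 by ring, Real.rpow_neg_one, ← div_eq_mul_inv]
      exact herr
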